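/- Let $\mathcal{B}$ be the rack on $\{1,\dots,6\}$ with $i\triangleright j=\varphi_i(j)$, where $\varphi_1=(2\,3\,4\,5)$, $\varphi_2=(1\,5\,6\,3)$, $\varphi_3=(1\,2\,6\,4)$, $\varphi_4=(1\,3\,6\,5)$, $\varphi_5=(1\,4\,6\,2)$, $\varphi_6=(2\,5\,4\,3)$ (it is isomorphic to the conjugacy class of $4$-cycles in the symmetric group $\mathbb{S}_4$, with $x\triangleright y=xyx^{-1}$). Let $G$ be its enveloping group, generated by $x_1,\dots,x_6$ with relations $x_ix_jx_i^{-1}=x_{i\triangleright j}$ for all $i,j$. Let $k$ be an arbitrary field and let $\rho$ be an absolutely simple representation over $k$ of the centralizer $C_G(x_1)$ (that is, $\rho$ is irreducible after every extension of the field $k$). The elements $x_1$ and $x_6$ belong to $C_G(x_1)$. Let $V=M(x_1,\rho)=\mathrm{Ind}_{C_G(x_1)}^G\rho$ be the induced Yetter-Drinfeld module over $kG$, with coaction $\delta(h\otimes w)=hx_1h^{-1}\otimes(h\otimes w)$ for $h\in G$ and $w$ in the representation space of $\rho$, let $d_V=\dim V$, and put $V_g=\{v\in V\mid\delta(v)=g\otimes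 v\}$ for $g\in G$. Let $\mathfrak{B}(V)=\bigoplus_{n\ge 0}\mathfrak{B}_n(V)$ be the Nichols algebra of $V$, that is, the quotient of the tensor algebra of $V$ by the kernels of the quantum symmetrizers of the braiding $c(v\otimes w)=gw\otimes v$ for $v\in V_g$, $w\in V$. For $n\ge 1$ write $(n)_t=1+t+\dots+t^{n-1}$. 1. The representation $\rho$ is a linear character (it is one-dimensional), hence $d_V=6$. Moreover, $\dim\mathfrak{B}_2(V)\le d_V(d_V+1)/2$ if and only if $\rho(x_1)=\rho(x_6)=-1$. 2. Assume that $\rho(x_1)=\rho(x_6)=-1$. Then the following hold. (a) The Hilbert series $\sum_{n\ge0}\dim\mathfrak{B}_n(V)\,t^n$ of $\mathfrak{B}(V)$ equals $(2)_t^2(3)_t^2(4)_t^2$, and $\dim\mathfrak{B}(V)=576$. (b) For any non-zero elements $v_i\in V_{x_i}$, $1\le i\le 6$, the monomial $v_1v_2v_1v_3v_2v_1v_4v_3v_2v_5v_4v_6$ is an integral of $\mathfrak{B}(V)$, that is, a non-zero element $\Lambda$ with $y\Lambda=\varepsilon(y)\Lambda=\Lambda y$ for all $y\in\mathfrak{B}(V)$,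 where $\varepsilon:\mathfrak{B}(V)\to k$ is the algebra map vanishing on $V$. -/

import Mathlib

open scoped TensorProduct

universe u v

noncomputable section

/-! ### Yetter-Drinfeld modules over a group algebra -/

/-- A (left-left) Yetter-Drinfeld module over the group algebra `k[G]`: a `k[G]`-module which is also
a left `k[G]`-comodule, with `δ (h v) = h v₍₋₁₎ h⁻¹ ⊗ h v₍₀₎`. -/
structure YetterDrinfeld (k G V : Type*) [Field k] [Group G] [AddCommGroup V] [Module k V] where
  /-- the action -/
  act : Representation k G V
  /-- the coaction -/
  coact : V →ₗ[k] MonoidAlgebra k G ⊗[k] V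
  coassoc : (TensorProduct.assoc k (MonoidAlgebra k G) (MonoidAlgebra k G) V).toLinearMap ∘ₗ
      (Coalgebra.comul (R := k) (A := MonoidAlgebra k G)).rTensor V ∘ₗ coact =
    coact.lTensor (MonoidAlgebra k G) ∘ₗ coact
  counit : (TensorProduct.lid k V).toLinearMap ∘ₗ
      (Coalgebra.counit (R := k) (A := MonoidAlgebra k G)).rTensor V ∘ₗ coact = LinearMap.id
  compat : ∀ h : G, coact ∘ₗ act h =
    TensorProduct.map
      (LinearMap.mulLeft k (MonoidAlgebra.single h (1 : k)) ∘ₗ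
        LinearMap.mulRight k (MonoidAlgebra.single h⁻¹ (1 : k))) (act h) ∘ₗ coact

namespace YetterDrinfeld

variable {k G V : Type*} [Field k] [Group G] [AddCommGroup V] [Module k V]

/-- The homogeneous component `V_g = {v | δ v = g ⊗ v}`. -/
def component (M : YetterDrinfeld k G V) (g : G) : Set V :=
  {w | M.coact w = MonoidAlgebra.single g (1 : k) ⊗ₜ[k] w}

/-- The braiding `c (v ⊗ w) = v₍₋₁₎ w ⊗ v₍₀₎`; thus `c (v ⊗ w) = g w ⊗ v` for `v ∈ V_g`. -/
def braiding (M : YetterDrinfeld k G V) : V ⊗[k] V →ₗ[k] V ⊗[k] V :=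
  (TensorProduct.lift M.act.asAlgebraHom.toLinearMap).rTensor V ∘ₗ
    (TensorProduct.rightComm k (MonoidAlgebra k G) V V).toLinearMap ∘ₗ M.coact.rTensor V

lemma braiding_tmul (M : YetterDrinfeld k G V) {g : G} {x : V} (hx : x ∈ M.component g) (y : V) :
    M.braiding (x ⊗ₜ y) = M.act g y ⊗ₜ x := by
  have hx' : M.coact x = MonoidAlgebra.single g (1 : k) ⊗ₜ[k] x := hx
  simp [braiding, hx', Representation.asAlgebraHom_single]

section Induced

variable {W : Type*} [AddCommGroup W] [Module k W]

/-- The coaction `δ (h ⊗ w) = h g h⁻¹ ⊗ (h ⊗ w)` on the representation induced from the centralizer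
of `g`. In Mathlib's model of the induced representation, `h ⊗ w` is the class
`IndV.mk _ _ h⁻¹ w` (see `Representation.ind_mk`). -/
def inducedCoact (g : G) (ρ : Representation k (Subgroup.centralizer {g}) W) :
    Representation.IndV (Subgroup.centralizer {g}).subtype ρ →ₗ[k]
      MonoidAlgebra k G ⊗[k] Representation.IndV (Subgroup.centralizer {g}).subtype ρ :=
  Representation.Coinvariants.lift _
    (TensorProduct.lift
      (Finsupp.lift _ k G (fun h =>
          TensorProduct.mk k _ _ (MonoidAlgebra.single (h⁻¹ * g * h) (1 : k)) ∘ₗ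
            Representation.IndV.mk (Subgroup.centralizer {g}).subtype ρ h) ∘ₗ
        (MonoidAlgebra.coeffLinearEquiv k).toLinearMap))
    (fun c => by
      ext h w
      have hc : (c : G)⁻¹ * g * c = g := by
        have := Subgroup.mem_centralizer_singleton_iff.1 c.2
        rw [mul_assoc, ← this, inv_mul_cancel_left]
      have e1 : h⁻¹ * (c : G)⁻¹ * g * (c * h) = h⁻¹ * g * h := by
        have : h⁻¹ * (c : G)⁻¹ * g * (c * h) = h⁻¹ * ((c : G)⁻¹ * g * c) * h := by group
        rw [this, hc]
      have e2 : Representation.IndV.mk (Subgroup.centralizer {g}).subtype ρ (c * h) (ρ c w) =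
          Representation.IndV.mk (Subgroup.centralizer {g}).subtype ρ h w := by
        have := Representation.Coinvariants.mk_self_apply
          (Representation.tprod ((Representation.leftRegular k G).comp
            (Subgroup.centralizer {g}).subtype) ρ) c (MonoidAlgebra.single h 1 ⊗ₜ[k] w)
        simpa using this
      simp only [LinearMap.coe_comp, Function.comp_apply] at e2
      simpa [e1] using congrArg (fun z => MonoidAlgebra.single (h⁻¹ * g * h) (1 : k) ⊗ₜ[k] z) e2)

lemma inducedCoact_mk (g : G) (ρ : Representation k (Subgroup.centralizer {g}) W) (h : G) (w : W) :
    inducedCoact g ρ (Representation.IndV.mk (Subgroup.centralizer {g}).subtype ρ h w) =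
      MonoidAlgebra.single (h⁻¹ * g * h) (1 : k) ⊗ₜ[k]
        Representation.IndV.mk (Subgroup.centralizer {g}).subtype ρ h w := by
  simp [inducedCoact]

/-- The Yetter-Drinfeld module `M(g, ρ)` induced by a representation `ρ` of the centralizer
of `g`. -/
def induced (g : G) (ρ : Representation k (Subgroup.centralizer {g}) W) :
    YetterDrinfeld k G (Representation.IndV (Subgroup.centralizer {g}).subtype ρ) where
  act := Representation.ind (Subgroup.centralizer {g}).subtype ρ
  coact := inducedCoact g ρ
  coassoc := by
    refine Representation.IndV.hom_ext _ _ fun h => LinearMap.ext fun w => ?_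
    have e := inducedCoact_mk g ρ h w
    change TensorProduct.assoc k _ _ _ (LinearMap.rTensor _ _ (inducedCoact g ρ
        (Representation.IndV.mk _ ρ h w))) = LinearMap.lTensor _ _ (inducedCoact g ρ
        (Representation.IndV.mk _ ρ h w))
    rw [e, LinearMap.lTensor_tmul, e, LinearMap.rTensor_tmul, MonoidAlgebra.comul_single]
    simp
  counit := by
    refine Representation.IndV.hom_ext _ _ fun h => LinearMap.ext fun w => ?_
    have e := inducedCoact_mk g ρ h w
    change TensorProduct.lid k _ (LinearMap.rTensor _ _ (inducedCoact g ρ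
        (Representation.IndV.mk _ ρ h w))) = Representation.IndV.mk _ ρ h w
    rw [e, LinearMap.rTensor_tmul, MonoidAlgebra.counit_single]
    simp
  compat := fun x => by
    refine Representation.IndV.hom_ext _ _ fun h => LinearMap.ext fun w => ?_
    have e := inducedCoact_mk g ρ h w
    change inducedCoact g ρ (Representation.ind _ ρ x (Representation.IndV.mk _ ρ h w)) =
      TensorProduct.map _ _ (inducedCoact g ρ (Representation.IndV.mk _ ρ h w))
    rw [e, Representation.ind_mk, inducedCoact_mk, TensorProduct.map_tmul, Representation.ind_mk]
    congr 1
    simp [MonoidAlgebra.single_mul_single, mul_assoc]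

end Induced

end YetterDrinfeld

/-! ### Nichols algebras -/

namespace Nichols

variable {k V : Type*} [Field k] [AddCommGroup V] [Module k V]

/-- The multiplication map `V ⊗ T(V) → T(V)`. -/
def leftMul : V ⊗[k] TensorAlgebra k V →ₗ[k] TensorAlgebra k V :=
  LinearMap.mul' k (TensorAlgebra k V) ∘ₗ (TensorAlgebra.ι k).rTensor (TensorAlgebra k V)

/-- The map `V ⊗ (V ⊗ T(V)) → V ⊗ T(V)` which applies the braiding `c` to the two leftmost
factors and then multiplies the second one into `T(V)`. -/
def push (c : V ⊗[k] V →ₗ[k] V ⊗[k] V) :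
    V ⊗[k] (V ⊗[k] TensorAlgebra k V) →ₗ[k] V ⊗[k] TensorAlgebra k V :=
  leftMul.lTensor V ∘ₗ (TensorProduct.assoc k V V (TensorAlgebra k V)).toLinearMap ∘ₗ
    c.rTensor (TensorAlgebra k V) ∘ₗ
      (TensorProduct.assoc k V V (TensorAlgebra k V)).symm.toLinearMap

/-- Auxiliary algebra map for `shuffle`. -/
def shuffleAux (c : V ⊗[k] V →ₗ[k] V ⊗[k] V) : TensorAlgebra k V →ₐ[k]
    Module.End k (TensorAlgebra k V × (V ⊗[k] TensorAlgebra k V)) :=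
  TensorAlgebra.lift k (TensorProduct.curry
    ((leftMul ∘ₗ (LinearMap.fst k _ _).lTensor V).prod
      ((LinearMap.fst k _ _).lTensor V + push c ∘ₗ (LinearMap.snd k _ _).lTensor V)))

/-- The linear map `T(V) → V ⊗ T(V)` which is `1 + c₁ + c₁ c₂ + ⋯ + c₁ c₂ ⋯ cₙ₋₁` on
`V^{⊗ n} = V ⊗ V^{⊗ (n - 1)}`, where `cᵢ` is the braiding acting on the factors `i` and `i + 1`.
It is determined by `shuffle_one` and `shuffle_ι_mul`. -/
def shuffle (c : V ⊗[k] V →ₗ[k] V ⊗[k] V) :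
    TensorAlgebra k V →ₗ[k] V ⊗[k] TensorAlgebra k V :=
  LinearMap.snd k _ _ ∘ₗ LinearMap.applyₗ (1, 0) ∘ₗ (shuffleAux c).toLinearMap

lemma shuffle_one (c : V ⊗[k] V →ₗ[k] V ⊗[k] V) : shuffle c 1 = 0 := by
  simp [shuffle]

lemma shuffleAux_fst (c : V ⊗[k] V →ₗ[k] V ⊗[k] V) (x : TensorAlgebra k V) :
    ∀ p, (shuffleAux c x p).1 = x * p.1 := by
  induction x using TensorAlgebra.induction with
  | algebraMap r => intro p; simp [Algebra.algebraMap_eq_smul_one]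
  | ι w => intro p; simp [shuffleAux, leftMul]
  | mul a b ha hb => intro p; simp [ha, hb, mul_assoc]
  | add a b ha hb => intro p; simp [ha, hb, add_mul]

lemma shuffle_ι_mul (c : V ⊗[k] V →ₗ[k] V ⊗[k] V) (w : V) (x : TensorAlgebra k V) :
    shuffle c (TensorAlgebra.ι k w * x) = w ⊗ₜ x + push c (w ⊗ₜ shuffle c x) := by
  have h := shuffleAux_fst c x (1, 0)
  simp only [mul_one] at h
  have h2 : shuffleAux c (TensorAlgebra.ι k w) = TensorProduct.curry
    ((leftMul ∘ₗ (LinearMap.fst k _ _).lTensor V).prod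
      ((LinearMap.fst k _ _).lTensor V + push c ∘ₗ (LinearMap.snd k _ _).lTensor V)) w := by
    simp [shuffleAux]
  simp [shuffle, h, h2]

/-- The quantum symmetrizer `𝔖ₙ` of the braided vector space `(V, c)`, acting on the degree `n`
part `V^{⊗ n}` of `T(V)`: `𝔖₀ = id` and
`𝔖ₙ₊₁ = (id ⊗ 𝔖ₙ) (1 + c₁ + c₁ c₂ + ⋯ + c₁ c₂ ⋯ cₙ)`.
On `V^{⊗ n}` this is the sum over all permutations of `n` letters of their Matsumoto lifts to
products of the `cᵢ`. -/
def symmetrizer (c : V ⊗[k] V →ₗ[k] V ⊗[k] V) : ℕ → TensorAlgebra k V →ₗ[k] TensorAlgebra k V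
  | 0 => LinearMap.id
  | n + 1 => leftMul ∘ₗ (symmetrizer c n).lTensor V ∘ₗ shuffle c

/-- The defining relations of the Nichols algebra: in each degree `n`, the elements of the kernel
of the quantum symmetrizer `𝔖ₙ : V^{⊗ n} → V^{⊗ n}` vanish. -/
def Rel (c : V ⊗[k] V →ₗ[k] V ⊗[k] V) (x y : TensorAlgebra k V) : Prop :=
  ∃ n : ℕ, x ∈ LinearMap.range (TensorAlgebra.ι k : V →ₗ[k] TensorAlgebra k V) ^ n ∧
    symmetrizer c n x = 0 ∧ y = 0

/-- The Nichols algebra `𝔅(V) = T(V) / ⨁ₙ ker 𝔖ₙ` of the braided vector space `(V, c)`. -/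
abbrev NicholsAlgebra (c : V ⊗[k] V →ₗ[k] V ⊗[k] V) : Type _ := RingQuot (Rel c)

/-- The canonical map `V → 𝔅(V)`. -/
def ι (c : V ⊗[k] V →ₗ[k] V ⊗[k] V) : V →ₗ[k] NicholsAlgebra c :=
  (RingQuot.mkAlgHom k (Rel c)).toLinearMap ∘ₗ TensorAlgebra.ι k

/-- The subspace `𝔅ₙ(V)` of homogeneous elements of degree `n`. -/
def homogeneous (c : V ⊗[k] V →ₗ[k] V ⊗[k] V) (n : ℕ) : Submodule k (NicholsAlgebra c) :=
  LinearMap.range (ι c) ^ n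

/-- The Hilbert series `∑ₙ dim 𝔅ₙ(V) tⁿ`. -/
def hilbertSeries (c : V ⊗[k] V →ₗ[k] V ⊗[k] V) : PowerSeries ℤ :=
  PowerSeries.mk fun n => (Module.finrank k (homogeneous c n) : ℤ)

/-- `(n)_t = 1 + t + ⋯ + t^{n-1}`. -/
def qNumber (n : ℕ) : PowerSeries ℤ := ∑ i ∈ Finset.range n, PowerSeries.X ^ i

/-- The counit `ε : 𝔅(V) → k`, which vanishes on `V`. -/
def counit (c : V ⊗[k] V →ₗ[k] V ⊗[k] V) : NicholsAlgebra c →ₐ[k] k :=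
  RingQuot.liftAlgHom k ⟨TensorAlgebra.algebraMapInv, by
    rintro x _ ⟨n, hx, hs, rfl⟩
    rw [map_zero]
    cases n with
    | zero => simp_all [symmetrizer]
    | succ n =>
      clear hs
      rw [pow_succ] at hx
      induction hx using Submodule.mul_induction_on' with
      | mem_mul_mem a _ b hb =>
        obtain ⟨w, rfl⟩ := hb
        simp [TensorAlgebra.algebraMapInv]
      | add a _ b _ ha hb => rw [map_add, ha, hb, add_zero]⟩

/-- A (two-sided) integral: a non-zero `Λ` with `x Λ = ε(x) Λ = Λ x` for all `x`. -/
def IsIntegral (c : V ⊗[k] V →ₗ[k] V ⊗[k] V) (Λ : NicholsAlgebra c) : Prop :=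
  Λ ≠ 0 ∧ ∀ x : NicholsAlgebra c, x * Λ = counit c x • Λ ∧ Λ * x = counit c x • Λ

end Nichols

/-! ### Absolutely simple representations -/

/-- Extension of scalars of a representation along a field extension `K / k`. -/
def Representation.extendScalars {k G W : Type*} [Field k] [Group G] [AddCommGroup W] [Module k W]
    (ρ : Representation k G W) (K : Type*) [Field K] [Algebra k K] :
    Representation K G (K ⊗[k] W) where
  toFun g := (ρ g).baseChange K
  map_one' := by ext; simp
  map_mul' _ _ := by ext; simp

/-- `ρ` is absolutely simple if `K ⊗ ρ` is irreducible for every field extension `K / k`. -/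
def Representation.IsAbsolutelySimple {k : Type u} {G W : Type*} [Field k] [Group G]
    [AddCommGroup W] [Module k W] (ρ : Representation k G W) : Prop :=
  ∀ (K : Type u) [Field K] [Algebra k K], (ρ.extendScalars K).IsIrreducible

/-! ### The rack of 4-cycles in the symmetric group on four letters -/

/-- The underlying set of the rack `ℬ`; the element called `i` in `{1, …, 6}` is `i - 1 : Fin 6`. -/
def RackB : Type := Fin 6

/-- The permutations `φ₁ = (2 3 4 5)`, `φ₂ = (1 5 6 3)`, `φ₃ = (1 2 6 4)`, `φ₄ = (1 3 6 5)`,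
`φ₅ = (1 4 6 2)`, `φ₆ = (2 5 4 3)`, with all labels decreased by one. -/
def phiB : Fin 6 → Equiv.Perm (Fin 6) :=
  ![c[1, 2, 3, 4], c[0, 4, 5, 2], c[0, 1, 5, 3], c[0, 2, 5, 4], c[0, 3, 5, 1], c[1, 4, 3, 2]]

lemma phiB_distrib : ∀ i j l : Fin 6, phiB i (phiB j l) = phiB (phiB i j) (phiB i l) := by
  decide

/-- The rack `ℬ`, with `i ▷ j = φᵢ(j)`. -/
instance : Rack RackB where
  act i j := phiB i j
  self_distrib {i j l} := phiB_distrib i j l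
  invAct i j := (phiB i).symm j
  left_inv i := (phiB i).left_inv
  right_inv i := (phiB i).right_inv

/-- The enveloping group `G_X` of `X = ℬ`. -/
abbrev GroupB : Type := Rack.EnvelGroup RackB

/-- The generators of `G_X`: `genB i` is the element usually called `x_{i+1}`. -/
def genB (i : Fin 6) : GroupB := Rack.toEnvelGroup RackB (i : RackB)

lemma genB_mul (i j : Fin 6) : genB i * genB j = genB (phiB i j) * genB i := by
  have h := (Rack.toEnvelGroup RackB).map_act' (x := (i : RackB)) (y := (j : RackB))
  have h' : genB (phiB i j) = genB i * genB j * (genB i)⁻¹ := h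
  rw [h', inv_mul_cancel_right]

/-- `x₁` as an element of the centralizer of `x₁`. -/
def cent1 : Subgroup.centralizer {genB 0} :=
  ⟨genB 0, Subgroup.mem_centralizer_singleton_iff.2 rfl⟩

/-- `x₆` as an element of the centralizer of `x₁`. -/
def cent6 : Subgroup.centralizer {genB 0} :=
  ⟨genB 5, Subgroup.mem_centralizer_singleton_iff.2 (by
    have h := genB_mul 0 5
    have h2 : phiB 0 5 = 5 := by decide
    rw [h2] at h
    exact h.symm)⟩

end

set_option linter.unusedSimpArgs false
set_option linter.unnecessarySeqFocus false

noncomputable section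

/-! ### Left skew derivations and kernels of the quantum symmetrizers -/

namespace Nichols

variable {k V : Type*} [Field k] [AddCommGroup V] [Module k V]

/-! Labels run from 0 to 5, as in `genB`; `R i` denotes a right skew derivation and `φ_i` is `phiB
i`.

The group. All products `x_i x_{opposite i}` coincide, so they are central. An element of `C_G(x_1)`
acts on the rack as a power of `φ_0`, and elements acting trivially are central; hence `C_G(x_1)` is
generated by the centre and `x_1`, and is commutative (`centralizer_mul_comm`). An absolutely simple
representation of a commutative group is a character, so `V` has a basis `u_0, …, u_5` with `u_i` of
degree `genB i` and `x_i u_j = a_ij u_{i▷j}`.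

Degree two. The kernel of `𝔖₂ = 1 + c` splits along the orbits of `(i, j) ↦ (i▷j, i)`: 6 of length
one, 3 of length two, 8 of length three. An orbit contributes at most one dimension, and only if the
product of the `-a_ij` around it is 1. The bound 21 on `dim 𝔅₂` forces the kernel to have dimension
at least 15, so each of the three classes of orbits must contribute. Since the orbit products are
expressed by `ρ(x_1)` and `ρ(x_6)`, both values are -1.

The Nichols algebra. If both values are -1, a rescaling by signs makes all `a_ij` equal to -1
(`exists_basis_braiding_eq_neg`). The kernel of `𝔖ₙ` can be tested with left skew derivations, which
come from the definition of `𝔖ₙ`, or with right ones, because the two kinds commute. The right ones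
descend to `𝔅(V)`, and only scalars are killed by all of them (`K_univ_le`). They satisfy `R_sq`,
`R_anticomm`, `R_triangle` and the quartic relation `R_quartic`, the latter being needed uniformly
in the characteristic.

With these relations the common kernels can be peeled off one index at a time: the common kernel of
`R i` for `i > s` is the direct sum of (the common kernel for `i ≥ s`) times the prefixes of a word,
the words being 5; 43; 321; 210; 10; 0 without their first letters altered, that is `[5]`, `[4,3]`,
`[3,2,1]`, `[2,1,0]`, `[1,0]`, `[0]`. Iterating `Block` gives a homogeneous basis with `2·3·4·4·3·2
= 576` elements, whence the Hilbert series. The product of the full words spans the top degree 12,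
so it is an integral, and `dim 𝔅₂ = 19 ≤ 21` gives the converse in degree two. -/

/-- Left induction on the tensor algebra of a module with a basis. -/
theorem tensorAlgebra_induction_left {I : Type*} (v : Module.Basis I k V)
    {P : TensorAlgebra k V → Prop}
    (one : P 1) (add : ∀ x y, P x → P y → P (x + y)) (smul : ∀ (r : k) x, P x → P (r • x))
    (mul : ∀ i x, P x → P (TensorAlgebra.ι k (v i) * x)) (x : TensorAlgebra k V) : P x := by
  have zero : P 0 := by simpa using smul 0 1 one
  suffices h : ∀ y, P y → P (x * y) by simpa using h 1 one
  induction x using TensorAlgebra.induction with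
  | algebraMap r => intro y hy; simpa [Algebra.algebraMap_eq_smul_one] using smul r y hy
  | ι w =>
    intro y hy
    induction v.mem_span w using Submodule.span_induction with
    | mem w hw => obtain ⟨i, rfl⟩ := hw; exact mul i y hy
    | zero => simpa using zero
    | add a b _ _ ha hb => simpa [add_mul] using add _ _ ha hb
    | smul r a _ ha => simpa using smul r _ ha
  | mul a b ha hb => intro y hy; simpa [mul_assoc] using ha _ (hb _ hy)
  | add a b ha hb => intro y hy; simpa [add_mul] using add _ _ (ha _ hy) (hb _ hy)

/-- Left induction on the homogeneous components of the tensor algebra. -/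
theorem tensorPower_induction_left {I : Type*} (v : Module.Basis I k V)
    {P : ℕ → TensorAlgebra k V → Prop}
    (one : P 0 1) (zero : ∀ n, P n 0) (add : ∀ n x y, P n x → P n y → P n (x + y))
    (smul : ∀ n (r : k) x, P n x → P n (r • x))
    (mul : ∀ n i x, x ∈ LinearMap.range (TensorAlgebra.ι k : V →ₗ[k] TensorAlgebra k V) ^ n →
      P n x → P (n + 1) (TensorAlgebra.ι k (v i) * x)) (n : ℕ) :
    ∀ x ∈ LinearMap.range (TensorAlgebra.ι k : V →ₗ[k] TensorAlgebra k V) ^ n, P n x := by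
  induction n with
  | zero =>
    intro x hx
    rw [pow_zero] at hx
    obtain ⟨r, rfl⟩ := Submodule.mem_one.1 hx
    rw [Algebra.algebraMap_eq_smul_one]
    exact smul _ _ _ one
  | succ n ih =>
    intro x hx
    rw [pow_succ'] at hx
    induction hx using Submodule.mul_induction_on' with
    | mem_mul_mem a ha b hb =>
      obtain ⟨w, rfl⟩ := ha
      induction v.mem_span w using Submodule.span_induction with
      | mem w hw => obtain ⟨i, rfl⟩ := hw; exact mul n i b hb (ih b hb)
      | zero => simpa using zero _
      | add a b _ _ ha hb => simpa [add_mul] using add _ _ _ ha hb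
      | smul r a _ ha => simpa using smul _ r _ ha
    | add a _ b _ ha hb => exact add _ _ _ ha hb

lemma leftMul_tmul (w : V) (x : TensorAlgebra k V) :
    leftMul (w ⊗ₜ[k] x) = TensorAlgebra.ι k w * x := rfl

/-- For the zero braiding, `shuffle` merely splits off the first letter, so it is a left inverse of
`leftMul`. -/
lemma leftMul_injective : Function.Injective (leftMul (k := k) (V := V)) := by
  have hp : push (0 : V ⊗[k] V →ₗ[k] V ⊗[k] V) = 0 := by
    simp [push, LinearMap.rTensor_zero]
  have h : shuffle (0 : V ⊗[k] V →ₗ[k] V ⊗[k] V) ∘ₗ leftMul = LinearMap.id := by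
    ext1
    ext1 w
    ext1 x
    simp [leftMul_tmul, shuffle_ι_mul, hp]
  exact Function.LeftInverse.injective (g := shuffle 0) fun z => LinearMap.congr_fun h z

lemma push_tmul_tmul (c : V ⊗[k] V →ₗ[k] V ⊗[k] V) {w a b : V} {r : k}
    (h : c (w ⊗ₜ a) = r • (b ⊗ₜ w)) (x : TensorAlgebra k V) :
    push c (w ⊗ₜ (a ⊗ₜ x)) = r • (b ⊗ₜ (TensorAlgebra.ι k w * x)) := by
  simp [push, h, leftMul_tmul, TensorProduct.smul_tmul']

section Braided

variable (v : Module.Basis (Fin 6) k V) (c : V ⊗[k] V →ₗ[k] V ⊗[k] V)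

/-- The left skew derivations of the tensor algebra, i.e. the coordinates of `shuffle c`. -/
def leftDer (i : Fin 6) : TensorAlgebra k V →ₗ[k] TensorAlgebra k V :=
  (TensorProduct.lid k _).toLinearMap ∘ₗ (v.coord i).rTensor _ ∘ₗ shuffle c

lemma leftDer_one (i : Fin 6) : leftDer v c i 1 = 0 := by simp [leftDer, shuffle_one]

/-- As `leftMul` is injective, the recursive definition of the symmetrizer can be read coordinate by
coordinate in the first factor. Lying in its kernel becomes a condition on iterated derivatives. -/
lemma symmetrizer_succ_eq_zero_iff (n : ℕ) (x : TensorAlgebra k V) :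
    symmetrizer c (n + 1) x = 0 ↔ ∀ i, symmetrizer c n (leftDer v c i x) = 0 := by
  have h1 : symmetrizer c (n + 1) x = leftMul ((symmetrizer c n).lTensor V (shuffle c x)) := rfl
  have h2 : ∀ i, symmetrizer c n (leftDer v c i x) =
      TensorProduct.lid k _ ((v.coord i).rTensor _ ((symmetrizer c n).lTensor V (shuffle c x))) := by
    intro i
    simp only [leftDer, LinearMap.comp_apply, LinearEquiv.coe_coe]
    generalize shuffle c x = z
    induction z using TensorProduct.induction_on with
    | zero => simp
    | tmul a b => simp
    | add a b ha hb => simp only [map_add, ha, hb]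
  rw [h1, map_eq_zero_iff _ leftMul_injective]
  simp only [h2]
  generalize (symmetrizer c n).lTensor V (shuffle c x) = z
  have key : z = ∑ i, v i ⊗ₜ (TensorProduct.lid k _ ((v.coord i).rTensor _ z)) := by
    induction z using TensorProduct.induction_on with
    | zero => simp
    | tmul a b =>
      conv_lhs => rw [← v.sum_repr a, TensorProduct.sum_tmul]
      simp [TensorProduct.smul_tmul']
    | add a b ha hb =>
      conv_lhs => rw [ha, hb]
      simp [TensorProduct.tmul_add, Finset.sum_add_distrib]
  refine ⟨fun h i => by simp [h], fun h => ?_⟩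
  rw [key]
  simp [h]

variable {c} (hc : ∀ i j, c (v i ⊗ₜ v j) = -(v (phiB i j) ⊗ₜ v i))
include hc

/-- Either `v j` itself is split off, or the letter split off from `x` crosses `v j`; it arrives as
`v i` exactly when it was `φ_j⁻¹ i` before the crossing. -/
lemma leftDer_basis_mul (i j : Fin 6) (x : TensorAlgebra k V) :
    leftDer v c i (TensorAlgebra.ι k (v j) * x) =
      (if i = j then x else 0) - TensorAlgebra.ι k (v j) * leftDer v c ((phiB j).symm i) x := by
  simp only [leftDer, LinearMap.comp_apply, shuffle_ι_mul, map_add, LinearEquiv.coe_coe]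
  rw [sub_eq_add_neg]
  congr 1
  · simp [Finsupp.single_apply, eq_comm]
  · generalize shuffle c x = z
    induction z using TensorProduct.induction_on with
    | zero => simp
    | tmul a b =>
      induction v.mem_span a using Submodule.span_induction with
      | mem w hw =>
        obtain ⟨l, rfl⟩ := hw
        rw [push_tmul_tmul c (r := -1) (b := v (phiB j l)) (by simp [hc])]
        simp [Finsupp.single_apply, Equiv.eq_symm_apply]
      | zero => simp
      | add a b _ _ ha hb => simp only [TensorProduct.add_tmul, TensorProduct.tmul_add, map_add, ha, hb, mul_add, neg_add]
      | smul r a _ ha =>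
        simp only [← TensorProduct.smul_tmul', TensorProduct.tmul_smul, map_smul, ha, mul_smul_comm, smul_neg]
    | add a b ha hb => simp only [TensorProduct.tmul_add, map_add, ha, hb, mul_add, neg_add]

lemma leftDer_basis (i j : Fin 6) :
    leftDer v c i (TensorAlgebra.ι k (v j)) = if i = j then 1 else 0 := by
  have := leftDer_basis_mul v hc i j 1
  simpa [leftDer_one] using this

end Braided

end Nichols

/-! ### Right skew derivations on the tensor algebra and on the Nichols algebra -/

namespace Nichols

/-- Elements `v i` of an algebra `B` together with algebra endomorphisms `g i` which act on them by
`v j ↦ - v (i ▷ j)`, and right skew derivations `R i` relative to the `g i` which are dual to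
the `v i`. -/
structure SkewSystem (k B : Type*) [Field k] [Ring B] [Algebra k B] where
  /-- the generators -/
  v : Fin 6 → B
  /-- the twisting endomorphisms -/
  g : Fin 6 → B →ₐ[k] B
  /-- the skew derivations -/
  R : Fin 6 → B →ₗ[k] B
  g_v : ∀ i j, g i (v j) = -v (phiB i j)
  R_v : ∀ i j, R i (v j) = if i = j then 1 else 0
  R_mul : ∀ i x y, R i (x * y) = x * R i y + R i x * g i y

/-- The block matrix form of a twisted derivation of the tensor algebra. -/
def twistMatrix {k V : Type*} [Field k] [AddCommGroup V] [Module k V]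
    (f : V →ₗ[k] k) (γ : V →ₗ[k] V) :
    TensorAlgebra k V →ₐ[k] Matrix (Fin 2) (Fin 2) (TensorAlgebra k V) :=
  TensorAlgebra.lift k
    { toFun := fun w => !![TensorAlgebra.ι k w, algebraMap k _ (f w); 0, TensorAlgebra.ι k (γ w)]
      map_add' := fun a b => by ext i j; fin_cases i <;> fin_cases j <;> simp
      map_smul' := fun r a => by
        ext i j; fin_cases i <;> fin_cases j <;> simp [Algebra.smul_def] }

section twist
variable {k V : Type*} [Field k] [AddCommGroup V] [Module k V] (f : V →ₗ[k] k) (γ : V →ₗ[k] V)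

lemma twistMatrix_ι (w : V) : twistMatrix f γ (TensorAlgebra.ι k w) =
    !![TensorAlgebra.ι k w, algebraMap k _ (f w); 0, TensorAlgebra.ι k (γ w)] := by
  simp [twistMatrix]

lemma twistMatrix_apply (x : TensorAlgebra k V) :
    twistMatrix f γ x 0 0 = x ∧ twistMatrix f γ x 1 0 = 0 ∧
      twistMatrix f γ x 1 1 = TensorAlgebra.lift k (TensorAlgebra.ι k ∘ₗ γ) x := by
  induction x using TensorAlgebra.induction with
  | algebraMap r =>
    simp only [AlgHom.commutes, Matrix.algebraMap_matrix_apply]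
    simp
  | ι w => simp [twistMatrix_ι]
  | mul a b ha hb => simp [Matrix.mul_apply, Fin.sum_univ_two, ha, hb]
  | add a b ha hb => simp [ha, hb]

/-- The right skew derivation of the tensor algebra which extends `f` and is twisted by `γ`. -/
def rightDer : TensorAlgebra k V →ₗ[k] TensorAlgebra k V where
  toFun x := twistMatrix f γ x 0 1
  map_add' x y := by simp
  map_smul' r x := by simp

/-- The endomorphism of the tensor algebra induced by `γ`. -/
def twist : TensorAlgebra k V →ₐ[k] TensorAlgebra k V :=
  TensorAlgebra.lift k (TensorAlgebra.ι k ∘ₗ γ)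

lemma twist_ι (w : V) : twist γ (TensorAlgebra.ι k w) = TensorAlgebra.ι k (γ w) := by
  simp [twist]

/-- The off-diagonal entry of a product of upper triangular matrices. Encoding the derivation in an
algebra map makes the universal properties of the tensor algebra and of its quotients available. -/
lemma rightDer_mul (x y : TensorAlgebra k V) :
    rightDer f γ (x * y) = x * rightDer f γ y + rightDer f γ x * twist γ y := by
  simp [rightDer, Matrix.mul_apply, Fin.sum_univ_two, twistMatrix_apply, twist]

lemma rightDer_ι (w : V) : rightDer f γ (TensorAlgebra.ι k w) = algebraMap k _ (f w) := by
  simp [rightDer, twistMatrix_ι]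

lemma twistMatrix_eq (x : TensorAlgebra k V) :
    twistMatrix f γ x = !![x, rightDer f γ x; 0, twist γ x] := by
  ext i j
  fin_cases i <;> fin_cases j <;> simp [twistMatrix_apply, rightDer, twist]

end twist

variable {k V : Type*} [Field k] [AddCommGroup V] [Module k V]

section Braided

variable (v : Module.Basis (Fin 6) k V)

/-- The action `v j ↦ - v (i ▷ j)` of a generator. -/
def gammaB (i : Fin 6) : V →ₗ[k] V := v.constr k fun j => -v (phiB i j)

lemma gammaB_basis (i j : Fin 6) : gammaB v i (v j) = -v (phiB i j) := by simp [gammaB]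

/-- The skew derivations of the tensor algebra. -/
def tensorSystem : SkewSystem k (TensorAlgebra k V) where
  v i := TensorAlgebra.ι k (v i)
  g i := twist (gammaB v i)
  R i := rightDer (v.coord i) (gammaB v i)
  g_v i j := by simp [twist_ι, gammaB_basis]
  R_v i j := by
    rw [rightDer_ι]
    by_cases h : i = j <;> simp [h]
  R_mul i := rightDer_mul _ _

namespace SkewSystem
variable {k B : Type*} [Field k] [Ring B] [Algebra k B] (Y : SkewSystem k B)

lemma R_one (i : Fin 6) : Y.R i 1 = 0 := by
  have := Y.R_mul i 1 1
  simpa using this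

lemma R_algebraMap (i : Fin 6) (r : k) : Y.R i (algebraMap k B r) = 0 := by
  rw [Algebra.algebraMap_eq_smul_one, map_smul, R_one, smul_zero]

lemma R_v_mul (i j : Fin 6) (x : B) :
    Y.R i (Y.v j * x) = Y.v j * Y.R i x + if i = j then Y.g i x else 0 := by
  rw [Y.R_mul, Y.R_v]; split_ifs <;> simp

lemma R_mul_v (i j : Fin 6) (x : B) :
    Y.R i (x * Y.v j) = (if i = j then x else 0) - Y.R i x * Y.v (phiB i j) := by
  rw [Y.R_mul, Y.R_v, Y.g_v]; split_ifs <;> simp [sub_eq_add_neg]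

end SkewSystem

variable {c : V ⊗[k] V →ₗ[k] V ⊗[k] V} (hc : ∀ i j, c (v i ⊗ₜ v j) = -(v (phiB i j) ⊗ₜ v i))
include hc

/-- The twist relabels the letters by `φ_a`, which respects all crossings by self-distributivity
(`hs`); the sign belongs to the one letter that is removed. -/
lemma leftDer_twist (i a : Fin 6) (x : TensorAlgebra k V) :
    leftDer v c i ((tensorSystem v).g a x) =
      -(tensorSystem v).g a (leftDer v c ((phiB a).symm i) x) := by
  revert i
  induction x using tensorAlgebra_induction_left v with
  | one => simp [leftDer_one]
  | add x y hx hy => intro i; simp only [map_add, hx, hy, neg_add]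
  | smul r x hx => intro i; simp only [map_smul, hx, smul_neg]
  | mul b x hx =>
    intro i
    have hg : (tensorSystem v).g a (TensorAlgebra.ι k (v b)) = -TensorAlgebra.ι k (v (phiB a b)) :=
      (tensorSystem v).g_v a b
    have hs : (phiB a).symm ((phiB (phiB a b)).symm i) = (phiB b).symm ((phiB a).symm i) := by
      rw [Equiv.symm_apply_eq, Equiv.symm_apply_eq, ← phiB_distrib]; simp
    rw [map_mul, hg, leftDer_basis_mul v hc, neg_mul, map_neg, leftDer_basis_mul v hc, hx, hs,
      map_sub, map_mul, hg]
    by_cases h : i = phiB a b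
    · simp [h]
    · have h' : ¬(phiB a).symm i = b := by rwa [Equiv.symm_apply_eq]
      simp [h, h']

/-- On `v a * x` the only terms not covered by induction are the left derivative of a twist and the
twist of a left derivative, and `leftDer_twist` matches them. -/
lemma leftDer_rightDer_comm (i j : Fin 6) (x : TensorAlgebra k V) :
    leftDer v c i ((tensorSystem v).R j x) = (tensorSystem v).R j (leftDer v c i x) := by
  revert i
  induction x using tensorAlgebra_induction_left v with
  | one => simp [leftDer_one, SkewSystem.R_one]
  | add x y hx hy => intro i; simp only [map_add, hx, hy]
  | smul r x hx => intro i; simp only [map_smul, hx]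
  | mul a x hx =>
    intro i
    have hR := (tensorSystem v).R_v_mul j a
    change ∀ x, (tensorSystem v).R j (TensorAlgebra.ι k (v a) * x) = TensorAlgebra.ι k (v a) * _ + _
      at hR
    rw [hR, map_add, leftDer_basis_mul v hc, leftDer_basis_mul v hc, map_sub, hR, hx]
    by_cases h : j = a
    · subst h
      by_cases h' : i = j <;> simp [h', leftDer_twist v hc] <;> abel
    · by_cases h' : i = a <;> simp [h, h']

lemma symmetrizer_twist (a : Fin 6) (n : ℕ) (x : TensorAlgebra k V) (h : symmetrizer c n x = 0) :
    symmetrizer c n ((tensorSystem v).g a x) = 0 := by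
  induction n generalizing x with
  | zero =>
    have : x = 0 := h
    simp [this]
  | succ n ih =>
    rw [symmetrizer_succ_eq_zero_iff v c] at h ⊢
    intro i
    rw [leftDer_twist v hc, map_neg, ih _ (h _), neg_zero]

lemma leftDer_mem (n : ℕ) (i : Fin 6) (x : TensorAlgebra k V)
    (hx : x ∈ LinearMap.range (TensorAlgebra.ι k : V →ₗ[k] TensorAlgebra k V) ^ (n + 1)) :
    leftDer v c i x ∈ LinearMap.range (TensorAlgebra.ι k : V →ₗ[k] TensorAlgebra k V) ^ n := by
  -- Degree zero is carried along separately: when `x` is a scalar, the product rule produces its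
  -- derivative, which has no lower component to lie in.
  suffices h : ∀ m, ∀ x ∈ LinearMap.range (TensorAlgebra.ι k : V →ₗ[k] TensorAlgebra k V) ^ m,
      (m = 0 → ∀ i, leftDer v c i x = 0) ∧ ∀ n, m = n + 1 → ∀ i,
        leftDer v c i x ∈ LinearMap.range (TensorAlgebra.ι k : V →ₗ[k] TensorAlgebra k V) ^ n from
    (h _ x hx).2 n rfl i
  intro m
  refine tensorPower_induction_left v (P := fun m x => (m = 0 → ∀ i, leftDer v c i x = 0) ∧
    ∀ n, m = n + 1 → ∀ i, leftDer v c i x ∈ LinearMap.range (TensorAlgebra.ι k : V →ₗ[k] TensorAlgebra k V) ^ n)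
    ?_ ?_ ?_ ?_ ?_ m
  · simp [leftDer_one]
  · intro n; simp
  · rintro n x y ⟨h1, h2⟩ ⟨h3, h4⟩
    refine ⟨fun h i => by simp [h1 h, h3 h], fun l h i => ?_⟩
    rw [map_add]; exact add_mem (h2 l h i) (h4 l h i)
  · rintro n r x ⟨h1, h2⟩
    refine ⟨fun h i => by simp [h1 h], fun l h i => ?_⟩
    rw [map_smul]; exact Submodule.smul_mem _ _ (h2 l h i)
  · rintro n j x hx ⟨h1, h2⟩
    refine ⟨fun h => by omega, fun l h i => ?_⟩
    obtain rfl : n = l := by omega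
    rw [leftDer_basis_mul v hc]
    refine sub_mem (by split_ifs; exacts [hx, zero_mem _]) ?_
    cases n with
    | zero => simp [h1 rfl]
    | succ n =>
      rw [pow_succ']
      exact Submodule.mul_mem_mul ⟨_, rfl⟩ (h2 n rfl _)

omit hc in
lemma twist_mem (n : ℕ) (a : Fin 6) (x : TensorAlgebra k V)
    (hx : x ∈ LinearMap.range (TensorAlgebra.ι k : V →ₗ[k] TensorAlgebra k V) ^ n) :
    (tensorSystem v).g a x ∈
      LinearMap.range (TensorAlgebra.ι k : V →ₗ[k] TensorAlgebra k V) ^ n := by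
  revert x
  refine tensorPower_induction_left v (P := fun n x => (tensorSystem v).g a x ∈
    LinearMap.range (TensorAlgebra.ι k : V →ₗ[k] TensorAlgebra k V) ^ n) ?_ ?_ ?_ ?_ ?_ n
  · simp
  · intro n; simp
  · intro n x y h1 h2; rw [map_add]; exact add_mem h1 h2
  · intro n r x h1; rw [map_smul]; exact Submodule.smul_mem _ _ h1
  · intro n j x hx h
    rw [map_mul, pow_succ']
    refine Submodule.mul_mem_mul ?_ h
    exact ⟨_, (twist_ι _ _).symm⟩

omit hc in
lemma rightDer_mem (n : ℕ) (i : Fin 6) (x : TensorAlgebra k V)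
    (hx : x ∈ LinearMap.range (TensorAlgebra.ι k : V →ₗ[k] TensorAlgebra k V) ^ (n + 1)) :
    (tensorSystem v).R i x ∈
      LinearMap.range (TensorAlgebra.ι k : V →ₗ[k] TensorAlgebra k V) ^ n := by
  suffices h : ∀ m, ∀ x ∈ LinearMap.range (TensorAlgebra.ι k : V →ₗ[k] TensorAlgebra k V) ^ m,
      (m = 0 → ∀ i, (tensorSystem v).R i x = 0) ∧ ∀ n, m = n + 1 → ∀ i, (tensorSystem v).R i x ∈
        LinearMap.range (TensorAlgebra.ι k : V →ₗ[k] TensorAlgebra k V) ^ n from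
    (h _ x hx).2 n rfl i
  intro m
  refine tensorPower_induction_left v (P := fun m x => (m = 0 → ∀ i, (tensorSystem v).R i x = 0) ∧
    ∀ n, m = n + 1 → ∀ i, (tensorSystem v).R i x ∈ LinearMap.range (TensorAlgebra.ι k : V →ₗ[k] TensorAlgebra k V) ^ n)
    ?_ ?_ ?_ ?_ ?_ m
  · simp [SkewSystem.R_one]
  · intro n; simp
  · rintro n x y ⟨h1, h2⟩ ⟨h3, h4⟩
    refine ⟨fun h i => by simp [h1 h, h3 h], fun l h i => ?_⟩
    rw [map_add]; exact add_mem (h2 l h i) (h4 l h i)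
  · rintro n r x ⟨h1, h2⟩
    refine ⟨fun h i => by simp [h1 h], fun l h i => ?_⟩
    rw [map_smul]; exact Submodule.smul_mem _ _ (h2 l h i)
  · rintro n j x hx ⟨h1, h2⟩
    refine ⟨fun h => by omega, fun l h i => ?_⟩
    obtain rfl : n = l := by omega
    have hR := (tensorSystem v).R_v_mul i j x
    change (tensorSystem v).R i (TensorAlgebra.ι k (v j) * x) = TensorAlgebra.ι k (v j) * _ + _
      at hR
    rw [hR]
    refine add_mem ?_ (by split_ifs; exacts [twist_mem v _ _ _ hx, zero_mem _])
    cases n with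
    | zero => simp [h1 rfl]
    | succ n =>
      rw [pow_succ']
      exact Submodule.mul_mem_mul ⟨_, rfl⟩ (h2 n rfl _)

/-- Left and right derivations agree in degree one. In higher degree, one left and one right
derivative are taken and interchanged, so the left test turns into the right test by induction. -/
lemma symmetrizer_succ_eq_zero_iff_rightDer (n : ℕ) (x : TensorAlgebra k V)
    (hx : x ∈ LinearMap.range (TensorAlgebra.ι k : V →ₗ[k] TensorAlgebra k V) ^ (n + 1)) :
    symmetrizer c (n + 1) x = 0 ↔ ∀ j, symmetrizer c n ((tensorSystem v).R j x) = 0 := by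
  rw [symmetrizer_succ_eq_zero_iff v c]
  induction n generalizing x with
  | zero =>
    have h : ∀ i, leftDer v c i x = (tensorSystem v).R i x := by
      intro i
      rw [zero_add, pow_one] at hx
      obtain ⟨w, rfl⟩ := hx
      induction v.mem_span w using Submodule.span_induction with
      | mem w hw =>
        obtain ⟨l, rfl⟩ := hw
        rw [leftDer_basis v hc]
        exact ((tensorSystem v).R_v i l).symm
      | zero => simp
      | add a b _ _ ha hb => simp only [map_add, ha, hb]
      | smul r a _ ha => simp only [map_smul, ha]
    simp only [h]
  | succ n ih =>
    have e1 : ∀ i, symmetrizer c (n + 1) (leftDer v c i x) = 0 ↔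
        ∀ j, symmetrizer c n ((tensorSystem v).R j (leftDer v c i x)) = 0 := fun i => by
      rw [← ih _ (leftDer_mem v hc _ i x hx), symmetrizer_succ_eq_zero_iff v c]
    have e2 : ∀ j, symmetrizer c (n + 1) ((tensorSystem v).R j x) = 0 ↔
        ∀ i, symmetrizer c n (leftDer v c i ((tensorSystem v).R j x)) = 0 := fun j =>
      symmetrizer_succ_eq_zero_iff v c _ _
    simp only [e1, e2, leftDer_rightDer_comm v hc]
    exact forall_comm

/-- The twisted derivation `R i` on the Nichols algebra, in block matrix form. -/
def nicholsMatrix (i : Fin 6) : NicholsAlgebra c →ₐ[k] Matrix (Fin 2) (Fin 2) (NicholsAlgebra c) :=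
  RingQuot.liftAlgHom k ⟨((RingQuot.mkAlgHom k (Rel c)).mapMatrix).comp
    (twistMatrix (v.coord i) (gammaB v i)), by
    rintro x _ ⟨n, hx, hs, rfl⟩
    have h0 : ∀ n, ∀ x ∈ LinearMap.range (TensorAlgebra.ι k : V →ₗ[k] TensorAlgebra k V) ^ n,
        symmetrizer c n x = 0 → RingQuot.mkAlgHom k (Rel c) x = 0 := fun n x hx hs => by
      rw [← map_zero (RingQuot.mkAlgHom k (Rel c))]
      exact RingQuot.mkAlgHom_rel k ⟨n, hx, hs, rfl⟩
    have h1 : RingQuot.mkAlgHom k (Rel c) (rightDer (v.coord i) (gammaB v i) x) = 0 := by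
      cases n with
      | zero =>
        have : x = 0 := hs
        simp [this]
      | succ n =>
        exact h0 n _ (rightDer_mem v n i x hx)
          ((symmetrizer_succ_eq_zero_iff_rightDer v hc n x hx).1 hs i)
    have h2 : RingQuot.mkAlgHom k (Rel c) (twist (gammaB v i) x) = 0 :=
      h0 n _ (twist_mem v n i x hx) (symmetrizer_twist v hc i n x hs)
    rw [map_zero, AlgHom.comp_apply, twistMatrix_eq]
    ext a b
    fin_cases a <;> fin_cases b <;> simp [h0 n x hx hs, h1, h2]⟩

lemma nicholsMatrix_mk (i : Fin 6) (x : TensorAlgebra k V) :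
    nicholsMatrix v hc i (RingQuot.mkAlgHom k (Rel c) x) =
      !![RingQuot.mkAlgHom k (Rel c) x, RingQuot.mkAlgHom k (Rel c) ((tensorSystem v).R i x); 0,
        RingQuot.mkAlgHom k (Rel c) ((tensorSystem v).g i x)] := by
  rw [nicholsMatrix, RingQuot.liftAlgHom_mkAlgHom_apply, AlgHom.comp_apply, twistMatrix_eq]
  ext a b
  fin_cases a <;> fin_cases b <;> simp <;> rfl

lemma nicholsMatrix_apply (i : Fin 6) (x : NicholsAlgebra c) :
    nicholsMatrix v hc i x 0 0 = x ∧ nicholsMatrix v hc i x 1 0 = 0 := by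
  obtain ⟨x, rfl⟩ := RingQuot.mkAlgHom_surjective k (Rel c) x
  rw [nicholsMatrix_mk]; simp

/-- The skew derivations of the Nichols algebra. -/
def nicholsSystem : SkewSystem k (NicholsAlgebra c) where
  v i := ι c (v i)
  g i := 
    { toFun := fun x => nicholsMatrix v hc i x 1 1
      map_one' := by simp
      map_zero' := by simp
      map_add' := by simp
      map_mul' := fun x y => by
        simp [Matrix.mul_apply, Fin.sum_univ_two, nicholsMatrix_apply]
      commutes' := fun r => by simp [Matrix.algebraMap_matrix_apply] }
  R i := 
    { toFun := fun x => nicholsMatrix v hc i x 0 1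
      map_add' := by simp
      map_smul' := by simp }
  g_v i j := by
    have h := nicholsMatrix_mk v hc i (TensorAlgebra.ι k (v j))
    have h2 := (tensorSystem v).g_v i j
    change (tensorSystem v).g i (TensorAlgebra.ι k (v j)) = - TensorAlgebra.ι k _ at h2
    simp [ι, h, h2]
  R_v i j := by
    have h := nicholsMatrix_mk v hc i (TensorAlgebra.ι k (v j))
    have h2 := (tensorSystem v).R_v i j
    change (tensorSystem v).R i (TensorAlgebra.ι k (v j)) = _ at h2
    simp only [ι, LinearMap.comp_apply, AlgHom.toLinearMap_apply, LinearMap.coe_mk, AddHom.coe_mk, h, h2]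
    split_ifs <;> simp
  R_mul i x y := by simp [Matrix.mul_apply, Fin.sum_univ_two, nicholsMatrix_apply]

lemma nicholsSystem_R_mk (i : Fin 6) (x : TensorAlgebra k V) :
    (nicholsSystem v hc).R i (RingQuot.mkAlgHom k (Rel c) x) =
      RingQuot.mkAlgHom k (Rel c) ((tensorSystem v).R i x) := by
  change nicholsMatrix v hc i _ 0 1 = _
  rw [nicholsMatrix_mk]; simp

omit hc in
lemma map_range_pow (n : ℕ) :
    (LinearMap.range (TensorAlgebra.ι k : V →ₗ[k] TensorAlgebra k V) ^ n).map
      (RingQuot.mkAlgHom k (Rel c)).toLinearMap = homogeneous c n := by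
  rw [homogeneous, Submodule.map_pow, ι, LinearMap.range_comp]

/-- The two-sided ideal generated by the relations contains no further homogeneous elements:
derivatives lower the degree to zero, where `counit` detects scalars. -/
lemma symmetrizer_eq_zero (n : ℕ) (x : TensorAlgebra k V)
    (hx : x ∈ LinearMap.range (TensorAlgebra.ι k : V →ₗ[k] TensorAlgebra k V) ^ n)
    (h : RingQuot.mkAlgHom k (Rel c) x = 0) : symmetrizer c n x = 0 := by
  induction n generalizing x with
  | zero =>
    rw [pow_zero] at hx
    obtain ⟨r, rfl⟩ := Submodule.mem_one.1 hx
    have : counit c (RingQuot.mkAlgHom k (Rel c) (algebraMap k _ r)) = 0 := by rw [h, map_zero]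
    rw [AlgHom.commutes, AlgHom.commutes] at this
    have : r = 0 := this
    simp [this]
  | succ n ih =>
    rw [symmetrizer_succ_eq_zero_iff_rightDer v hc n x hx]
    intro j
    refine ih _ (rightDer_mem v n j x hx) ?_
    rw [← nicholsSystem_R_mk v hc, h, map_zero]

/-- This is where the maximality of the defining ideal of a Nichols algebra enters: an element of
positive degree without nonzero derivatives is already a relation. -/
lemma eq_zero_of_R_eq_zero (n : ℕ) (x : NicholsAlgebra c) (hx : x ∈ homogeneous c (n + 1))
    (h : ∀ j, (nicholsSystem v hc).R j x = 0) : x = 0 := by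
  rw [← map_range_pow] at hx
  obtain ⟨y, hy, rfl⟩ := hx
  have hs : symmetrizer c (n + 1) y = 0 := by
    rw [symmetrizer_succ_eq_zero_iff_rightDer v hc n y hy]
    intro j
    refine symmetrizer_eq_zero v hc n _ (rightDer_mem v n j y hy) ?_
    rw [← nicholsSystem_R_mk v hc]
    exact h j
  rw [← map_zero (RingQuot.mkAlgHom k (Rel c)).toLinearMap]
  exact RingQuot.mkAlgHom_rel k ⟨n + 1, hy, hs, rfl⟩

lemma nicholsSystem_R_mem (n : ℕ) (j : Fin 6) (x : NicholsAlgebra c)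
    (hx : x ∈ homogeneous c (n + 1)) : (nicholsSystem v hc).R j x ∈ homogeneous c n := by
  rw [← map_range_pow] at hx ⊢
  obtain ⟨y, hy, rfl⟩ := hx
  exact ⟨_, rightDer_mem v n j y hy, (nicholsSystem_R_mk v hc j y).symm⟩

end Braided

end Nichols

/-! ### Quadratic relations between the skew derivations -/

namespace Nichols
namespace SkewSystem

variable {k B : Type*} [Field k] [Ring B] [Algebra k B] (Y : SkewSystem k B)

section Relations

variable (hY : Algebra.adjoin k (Set.range Y.v) = ⊤)
include hY

theorem induction_right {P : B → Prop} (one : P 1) (add : ∀ x y, P x → P y → P (x + y))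
    (smul : ∀ (r : k) x, P x → P (r • x)) (mul : ∀ i x, P x → P (x * Y.v i)) (x : B) : P x := by
  have hx : x ∈ Algebra.adjoin k (Set.range Y.v) := by rw [hY]; trivial
  suffices h : ∀ y, P y → P (y * x) by simpa using h 1 one
  induction hx using Algebra.adjoin_induction with
  | mem x hx => obtain ⟨i, rfl⟩ := hx; exact fun y hy => mul i y hy
  | algebraMap r => intro y hy; simpa [Algebra.algebraMap_eq_smul_one] using smul r y hy
  | add a b _ _ ha hb => intro y hy; simpa [mul_add] using add _ _ (ha _ hy) (hb _ hy)
  | mul a b _ _ ha hb => intro y hy; simpa [mul_assoc] using hb _ (ha _ hy)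

/-- Here and in the next two relations, a double derivative of `x * v e` consists of a second-order
term times one letter, handled by induction, and of first-order terms, which cancel along an orbit
of `(i, j) ↦ (i▷j, i)`. -/
lemma R_sq (a : Fin 6) (x : B) : Y.R a (Y.R a x) = 0 := by
  have haa : phiB a a = a := by revert a; decide
  induction x using Y.induction_right hY with
  | one => simp [R_one]
  | add x y hx hy => simp [hx, hy]
  | smul r x hx => simp [hx]
  | mul e x hx =>
    have h : (a = phiB a e) = (a = e) := by
      have : phiB a a = phiB a e ↔ a = e := (phiB a).apply_eq_iff_eq
      rwa [haa, ← eq_iff_iff] at this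
    simp only [R_mul_v, map_sub, hx, h, zero_mul, sub_zero]
    split_ifs <;> simp

lemma R_anticomm {a b : Fin 6} (h1 : phiB a b = b) (h2 : phiB b a = a) (x : B) :
    Y.R a (Y.R b x) = -Y.R b (Y.R a x) := by
  rw [eq_neg_iff_add_eq_zero]
  induction x using Y.induction_right hY with
  | one => simp [R_one]
  | add x y hx hy => simpa [add_add_add_comm] using congrArg₂ (· + ·) hx hy
  | smul r x hx => simp [← smul_add, hx]
  | mul e x hx =>
    have e1 : (a = phiB b e) = (a = e) := by
      have : phiB b a = phiB b e ↔ a = e := (phiB b).apply_eq_iff_eq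
      rwa [h2, ← eq_iff_iff] at this
    have e2 : (b = phiB a e) = (b = e) := by
      have : phiB a b = phiB a e ↔ b = e := (phiB a).apply_eq_iff_eq
      rwa [h1, ← eq_iff_iff] at this
    have e3 := phiB_distrib a b e
    rw [h1] at e3
    simp only [R_mul_v, map_sub, e1, e2, e3]
    have hx' := congrArg (· * Y.v (phiB b (phiB a e))) hx
    simp only [add_mul, zero_mul] at hx'
    have : ∀ p q r s t u : B, t + u = 0 → p - (q - t) + (r - (s - u)) = (p - s) + (r - q) := by
      intro p q r s t u h
      rw [← sub_eq_zero, ← h]; abel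
    rw [this _ _ _ _ _ _ hx']
    split_ifs <;> simp

/-- Self-distributivity gives `a▷(b▷e) = c▷(a▷e) = b▷(c▷e)`, so the three second-order terms end in
the same letter; `e1`, `e2`, `e3` cancel the first-order terms cyclically. -/
lemma R_triangle {a b c : Fin 6} (h1 : phiB a b = c) (h2 : phiB b c = a) (h3 : phiB c a = b)
    (x : B) : Y.R a (Y.R b x) + Y.R c (Y.R a x) + Y.R b (Y.R c x) = 0 := by
  induction x using Y.induction_right hY with
  | one => simp [R_one]
  | add x y hx hy =>
    have := congrArg₂ (· + ·) hx hy
    simp only [map_add]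
    rw [add_zero] at this
    rw [← this]; abel
  | smul r x hx => simp [← smul_add, hx]
  | mul e x hx =>
    have e1 : (c = phiB a e) = (b = e) := by
      rw [eq_iff_iff, ← h1, (phiB _).apply_eq_iff_eq]
    have e2 : (a = phiB b e) = (c = e) := by
      rw [eq_iff_iff, ← h2, (phiB _).apply_eq_iff_eq]
    have e3 : (b = phiB c e) = (a = e) := by
      rw [eq_iff_iff, ← h3, (phiB _).apply_eq_iff_eq]
    have e4 := phiB_distrib a b e
    have e5 := phiB_distrib b c e
    rw [h1] at e4
    rw [h2] at e5
    simp only [R_mul_v, map_sub, e1, e2, e3, e4, e5]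
    have hx' := congrArg (· * Y.v (phiB c (phiB a e))) hx
    simp only [add_mul, zero_mul] at hx'
    have : ∀ p q r s t u l m n : B, l + m + n = 0 →
        p - (q - l) + (r - (s - m)) + (t - (u - n)) = (p - s) + (r - u) + (t - q) := by
      intro p q r s t u l m n h
      rw [← sub_eq_zero, ← h]; abel
    rw [this _ _ _ _ _ _ _ _ _ (by rw [← hx', ← e4, ← e5])]
    split_ifs <;> simp

end Relations

/-- The common kernel of the skew derivations with index in `S`. -/
def K (S : Set (Fin 6)) : Submodule k B where
  carrier := {x | ∀ s ∈ S, Y.R s x = 0}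
  zero_mem' := by simp
  add_mem' := fun ha hb s hs => by rw [map_add, ha s hs, hb s hs, add_zero]
  smul_mem' := fun r x hx s hs => by rw [map_smul, hx s hs, smul_zero]

lemma mem_K {S : Set (Fin 6)} {x : B} : x ∈ Y.K S ↔ ∀ s ∈ S, Y.R s x = 0 := Iff.rfl

end SkewSystem

/-! ### Peeling a common kernel by triangular elimination -/

section Block

variable {k B : Type*} [Field k] [Ring B] [Algebra k B]

/-- Data exhibiting `K` as the direct sum of the `K' * p l` for `l < n`. -/
structure Block (K K' : Submodule k B) (n : ℕ) (p : ℕ → B) (P : ℕ → B →ₗ[k] B) : Prop where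
  pos : 0 < n
  P_zero : P 0 = LinearMap.id
  mul_mem : ∀ x ∈ K', ∀ l < n, x * p l ∈ K
  P_self : ∀ x ∈ K', ∀ l < n, P l (x * p l) = x
  P_lt : ∀ x ∈ K', ∀ l m, l < m → m < n → P m (x * p l) = 0
  P_mem : ∀ x ∈ K, ∀ l < n, (∀ m, l < m → m < n → P m x = 0) → P l x ∈ K'

variable {K K' : Submodule k B} {n : ℕ} {p : ℕ → B} {P : ℕ → B →ₗ[k] B}

/-- Elimination from the top: the last non-zero `P m x` lies in `K'`, and subtracting `P m x * p m`
kills it without disturbing the higher ones. -/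
lemma Block.span (H : Block K K' n p P) {I : Type*} (e : I → B)
    (he : K' ≤ Submodule.span k (Set.range e)) :
    K ≤ Submodule.span k (Set.range fun x : I × Fin n => e x.1 * p x.2) := by
  suffices h : ∀ m ≤ n, ∀ x ∈ K, (∀ l, m ≤ l → l < n → P l x = 0) →
      x ∈ Submodule.span k (Set.range fun x : I × Fin n => e x.1 * p x.2) from
    fun x hx => h n le_rfl x hx fun l h1 h2 => by omega
  intro m
  induction m with
  | zero =>
    intro hm x hx h
    have := h 0 le_rfl H.pos
    rw [H.P_zero] at this
    simp only [LinearMap.id_apply] at this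
    simp [this]
  | succ m ih =>
    intro hm x hx h
    have hk := H.P_mem x hx m hm h
    have hx' := ih (by omega) (x - P m x * p m) (sub_mem hx (H.mul_mem _ hk m hm)) (by
      intro l hl hln
      rcases hl.eq_or_lt with rfl | hl
      · rw [map_sub, H.P_self _ hk _ hm, sub_self]
      · rw [map_sub, H.P_lt _ hk _ _ hl hln, h l hl hln, sub_zero])
    have h2 : P m x * p m ∈
        Submodule.span k (Set.range fun x : I × Fin n => e x.1 * p x.2) := by
      have hk' := he hk
      generalize P m x = y at hk'
      induction hk' using Submodule.span_induction with
      | mem y hy =>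
        obtain ⟨i, rfl⟩ := hy
        exact Submodule.subset_span ⟨(i, ⟨m, hm⟩), rfl⟩
      | zero => simp
      | add a b _ _ ha hb => rw [add_mul]; exact add_mem ha hb
      | smul r a _ ha => rw [smul_mul_assoc]; exact Submodule.smul_mem _ _ ha
    simpa using add_mem hx' h2

lemma Block.linearIndependent (H : Block K K' n p P) {I : Type*} [Fintype I] (e : I → B)
    (he : LinearIndependent k e) (heK : ∀ i, e i ∈ K') :
    LinearIndependent k fun x : I × Fin n => e x.1 * p x.2 := by
  rw [Fintype.linearIndependent_iff]
  intro f hf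
  rw [Fintype.sum_prod_type_right] at hf
  simp only [← smul_mul_assoc, ← Finset.sum_mul] at hf
  set g : Fin n → B := fun l => ∑ i, f (i, l) • e i with hg
  have hgK : ∀ l, g l ∈ K' := fun l => Submodule.sum_mem _ fun i _ => Submodule.smul_mem _ _ (heK i)
  -- Downward induction on the index: `n ≤ l + d` selects the last `d` coefficients, and `P l`
  -- isolates the next one.
  have key : ∀ d, ∀ l : Fin n, n ≤ l + d → g l = 0 := by
    intro d
    induction d with
    | zero => intro l hl; omega
    | succ d ih =>
      intro l hl
      have h := congrArg (P l) hf
      rw [map_sum, map_zero, Finset.sum_eq_single l] at h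
      · rwa [H.P_self _ (hgK l) l l.2] at h
      · intro j _ hj
        rcases lt_or_gt_of_ne hj with h1 | h1
        · exact H.P_lt _ (hgK j) j l h1 l.2
        · have h2 := ih j (by have : (l : ℕ) < j := h1; omega)
          change P l (g j * p j) = 0
          rw [h2, zero_mul, map_zero]
      · simp
  rintro ⟨i, l⟩
  exact Fintype.linearIndependent_iff.1 he (fun i => f (i, l)) (key n l (by omega)) i

end Block

end Nichols

/-! ### The quartic relation and the six factorizations -/

namespace Nichols

lemma phiB_values :
    phiB 0 0 = 0 ∧ phiB 0 1 = 2 ∧ phiB 0 2 = 3 ∧ phiB 0 3 = 4 ∧ phiB 0 4 = 1 ∧ phiB 0 5 = 5 ∧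
    phiB 1 0 = 4 ∧ phiB 1 1 = 1 ∧ phiB 1 2 = 0 ∧ phiB 1 3 = 3 ∧ phiB 1 4 = 5 ∧ phiB 1 5 = 2 ∧
    phiB 2 0 = 1 ∧ phiB 2 1 = 5 ∧ phiB 2 2 = 2 ∧ phiB 2 3 = 0 ∧ phiB 2 4 = 4 ∧ phiB 2 5 = 3 ∧
    phiB 3 0 = 2 ∧ phiB 3 1 = 1 ∧ phiB 3 2 = 5 ∧ phiB 3 3 = 3 ∧ phiB 3 4 = 0 ∧ phiB 3 5 = 4 ∧
    phiB 4 0 = 3 ∧ phiB 4 1 = 0 ∧ phiB 4 2 = 2 ∧ phiB 4 3 = 5 ∧ phiB 4 4 = 4 ∧ phiB 4 5 = 1 ∧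
    phiB 5 0 = 0 ∧ phiB 5 1 = 4 ∧ phiB 5 2 = 1 ∧ phiB 5 3 = 2 ∧ phiB 5 4 = 3 ∧ phiB 5 5 = 5 := by
  decide

namespace SkewSystem

variable {k B : Type*} [Field k] [Ring B] [Algebra k B] (Y : SkewSystem k B)
variable (hY : Algebra.adjoin k (Set.range Y.v) = ⊤)
include hY

/-- A relation of degree four. In characteristic two it is not a consequence of the quadratic
relations. -/
lemma R_quartic (x : B) : Y.R 0 (Y.R 1 (Y.R 4 (Y.R 3 x))) + Y.R 1 (Y.R 4 (Y.R 3 (Y.R 0 x))) +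
    Y.R 4 (Y.R 3 (Y.R 0 (Y.R 1 x))) + Y.R 3 (Y.R 0 (Y.R 1 (Y.R 4 x))) = 0 := by
  induction x using Y.induction_right hY with
  | one => simp [R_one]
  | add x y hx hy =>
    have := congrArg₂ (· + ·) hx hy
    simp only [map_add]
    rw [add_zero] at this
    rw [← this]; abel
  | smul r x hx => simp only [map_smul, ← smul_add, hx, smul_zero]
  | mul e x hx =>
    have c13 : ∀ y, Y.R 3 (Y.R 1 y) = -Y.R 1 (Y.R 3 y) := fun y =>
      Y.R_anticomm hY (by decide) (by decide) y
    have t40 : ∀ y, Y.R 4 (Y.R 0 y) = -Y.R 3 (Y.R 4 y) - Y.R 0 (Y.R 3 y) := fun y => by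
      have := Y.R_triangle hY (a := 4) (b := 0) (c := 3) (by decide) (by decide) (by decide) y
      rw [add_assoc, add_eq_zero_iff_eq_neg] at this
      rw [this]; abel
    have t04 : ∀ y, Y.R 0 (Y.R 4 y) = -Y.R 1 (Y.R 0 y) - Y.R 4 (Y.R 1 y) := fun y => by
      have := Y.R_triangle hY (a := 0) (b := 4) (c := 1) (by decide) (by decide) (by decide) y
      rw [add_assoc, add_eq_zero_iff_eq_neg] at this
      rw [this]; abel
    -- Only for the letters `e = 2` and `e = 5`, which do not occur in the relation, are the
    -- third-order terms left over by the product rule not formally zero; `d2` and `d5` dispose of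
    -- them by quadratic relations.
    have d2 : Y.R 0 (Y.R 4 (Y.R 3 x)) + Y.R 3 (Y.R 1 (Y.R 4 x)) - Y.R 1 (Y.R 4 (Y.R 0 x)) -
        Y.R 4 (Y.R 3 (Y.R 1 x)) = 0 := by
      rw [t04, t40, c13, c13]
      simp only [map_sub, map_neg]
      abel
    have d5 : Y.R 0 (Y.R 1 (Y.R 3 x)) + Y.R 3 (Y.R 0 (Y.R 4 x)) - Y.R 1 (Y.R 3 (Y.R 0 x)) -
        Y.R 4 (Y.R 0 (Y.R 1 x)) = 0 := by
      rw [t04, t40, c13 x, ← neg_neg (Y.R 1 (Y.R 3 (Y.R 0 x))), ← c13]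
      simp only [map_sub, map_neg]
      abel
    have hx' : ∀ z, Y.R 0 (Y.R 1 (Y.R 4 (Y.R 3 x))) * z + Y.R 1 (Y.R 4 (Y.R 3 (Y.R 0 x))) * z +
        Y.R 4 (Y.R 3 (Y.R 0 (Y.R 1 x))) * z + Y.R 3 (Y.R 0 (Y.R 1 (Y.R 4 x))) * z = 0 := by
      intro z; rw [← add_mul, ← add_mul, ← add_mul, hx, zero_mul]
    simp only [R_mul_v, map_sub]
    fin_cases e <;> simp [phiB_values]
    · linear_combination (norm := abel) hx' (Y.v 0)
    · linear_combination (norm := abel) hx' (Y.v 1)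
    · linear_combination (norm := abel) hx' (Y.v 2) + d2
    · linear_combination (norm := abel) hx' (Y.v 3)
    · linear_combination (norm := abel) hx' (Y.v 4)
    · linear_combination (norm := abel) hx' (Y.v 5) - d5

lemma R_anticomm_opposite {a b : Fin 6} (h : phiB a b = b ∧ phiB b a = a) {x : B}
    (hx : Y.R b x = 0) : Y.R b (Y.R a x) = 0 := by
  rw [Y.R_anticomm hY h.2 h.1, hx, map_zero, neg_zero]

lemma R_triangle' {a b c : Fin 6} (h : phiB a b = c ∧ phiB b c = a ∧ phiB c a = b) (x : B) :
    Y.R a (Y.R b x) = -Y.R c (Y.R a x) - Y.R b (Y.R c x) := by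
  have := Y.R_triangle hY h.1 h.2.1 h.2.2 x
  rw [add_assoc, add_eq_zero_iff_eq_neg] at this
  rw [this]; abel

omit hY

/-- The product of the first `l` letters of a word. -/
def wordPrefix (w : List (Fin 6)) (l : ℕ) : B := ((w.take l).map Y.v).prod

include hY

lemma block_six : Block (Y.K ∅) (Y.K {5}) 2 (Y.wordPrefix [5]) (fun
    | 0 => LinearMap.id
    | _ => Y.R 5) where
  pos := by norm_num
  P_zero := rfl
  mul_mem x hx l hl := by simp [mem_K]
  P_self x hx l hl := by
    simp only [mem_K, Set.mem_singleton_iff, forall_eq] at hx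
    interval_cases l <;> simp [wordPrefix, R_mul, hx, R_v, R_one, g_v, phiB_values]
  P_lt x hx l m hl hm := by
    simp only [mem_K, Set.mem_singleton_iff, forall_eq] at hx
    interval_cases m <;> interval_cases l <;>
      simp [wordPrefix, R_mul, hx, R_v, R_one, g_v, phiB_values]
  P_mem x hx l hl h := by
    simp only [mem_K, Set.mem_singleton_iff, forall_eq]
    interval_cases l
    · exact h 1 (by norm_num) (by norm_num)
    · exact Y.R_sq hY 5 x

/-- The maps `P l` strip the letters of a prefix from the left, relabelled by the letters already
removed. Since `4▷3 = 5`, one has `R 4 (x v₄ v₃) = -x v₅` for `x` in the smaller kernel, which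
explains `-R 5 R 4`. The relations between the derivations enter only through `P_mem`. -/
lemma block_five : Block (Y.K {5}) (Y.K {4, 5}) 3 (Y.wordPrefix [4, 3]) (fun
    | 0 => LinearMap.id
    | 1 => Y.R 4
    | _ => -(Y.R 5 ∘ₗ Y.R 4)) where
  pos := by norm_num
  P_zero := rfl
  mul_mem x hx l hl := by
    simp only [mem_K, Set.mem_insert_iff, Set.mem_singleton_iff, forall_eq_or_imp, forall_eq] at hx ⊢
    interval_cases l <;> simp [wordPrefix, R_mul, hx, R_v, R_one, g_v, phiB_values]
  P_self x hx l hl := by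
    simp only [mem_K, Set.mem_insert_iff, Set.mem_singleton_iff, forall_eq_or_imp, forall_eq] at hx
    interval_cases l <;> simp [wordPrefix, R_mul, hx, R_v, R_one, g_v, phiB_values]
  P_lt x hx l m hl hm := by
    simp only [mem_K, Set.mem_insert_iff, Set.mem_singleton_iff, forall_eq_or_imp, forall_eq] at hx
    interval_cases m <;> interval_cases l <;>
      simp [wordPrefix, R_mul, hx, R_v, R_one, g_v, phiB_values]
  P_mem x hx l hl h := by
    simp only [mem_K, Set.mem_insert_iff, Set.mem_singleton_iff, forall_eq_or_imp, forall_eq] at hx ⊢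
    interval_cases l
    · exact ⟨h 1 (by norm_num) (by norm_num), hx⟩
    · have h2 := h 2 (by norm_num) (by norm_num)
      simp only [LinearMap.neg_apply, LinearMap.comp_apply, neg_eq_zero] at h2
      exact ⟨Y.R_sq hY 4 x, h2⟩
    · simp only [LinearMap.neg_apply, LinearMap.comp_apply, map_neg, neg_eq_zero]
      refine ⟨?_, Y.R_sq hY 5 _⟩
      rw [Y.R_triangle' hY (a := 4) (b := 5) (c := 1) (by decide),
        Y.R_triangle' hY (a := 1) (b := 4) (c := 5) (by decide) x]
      simp [hx, Y.R_sq hY]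

/-- Stripping 3 turns the letters 2, 1 into `3▷2 = 5` and `3▷1 = 1`; stripping 5 turns 1 into `5▷1 =
4`. This gives the sequence 3, 5, 4 of derivations and the sign. -/
lemma block_four : Block (Y.K {4, 5}) (Y.K {3, 4, 5}) 4 (Y.wordPrefix [3, 2, 1]) (fun
    | 0 => LinearMap.id
    | 1 => Y.R 3
    | 2 => -(Y.R 5 ∘ₗ Y.R 3)
    | _ => -(Y.R 4 ∘ₗ Y.R 5 ∘ₗ Y.R 3)) where
  pos := by norm_num
  P_zero := rfl
  mul_mem x hx l hl := by
    simp only [mem_K, Set.mem_insert_iff, Set.mem_singleton_iff, forall_eq_or_imp, forall_eq] at hx ⊢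
    interval_cases l <;> simp [wordPrefix, R_mul, hx, R_v, R_one, g_v, phiB_values]
  P_self x hx l hl := by
    simp only [mem_K, Set.mem_insert_iff, Set.mem_singleton_iff, forall_eq_or_imp, forall_eq] at hx
    interval_cases l <;> simp [wordPrefix, R_mul, hx, R_v, R_one, g_v, phiB_values]
  P_lt x hx l m hl hm := by
    simp only [mem_K, Set.mem_insert_iff, Set.mem_singleton_iff, forall_eq_or_imp, forall_eq] at hx
    interval_cases m <;> interval_cases l <;>
      simp [wordPrefix, R_mul, hx, R_v, R_one, g_v, phiB_values]
  P_mem x hx l hl h := by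
    simp only [mem_K, Set.mem_insert_iff, Set.mem_singleton_iff, forall_eq_or_imp, forall_eq] at hx ⊢
    obtain ⟨h4, h5⟩ := hx
    have e43 : Y.R 4 (Y.R 3 x) = 0 := by
      rw [Y.R_triangle' hY (a := 4) (b := 3) (c := 5) (by decide)]; simp [h4, h5]
    have e353 : Y.R 3 (Y.R 5 (Y.R 3 x)) = 0 := by
      rw [Y.R_triangle' hY (a := 3) (b := 5) (c := 4) (by decide)]; simp [e43, Y.R_sq hY]
    interval_cases l
    · exact ⟨h 1 (by norm_num) (by norm_num), h4, h5⟩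
    · have h2 := h 2 (by norm_num) (by norm_num)
      simp only [LinearMap.neg_apply, LinearMap.comp_apply, neg_eq_zero] at h2
      exact ⟨Y.R_sq hY 3 x, e43, h2⟩
    · have h3 := h 3 (by norm_num) (by norm_num)
      simp only [LinearMap.neg_apply, LinearMap.comp_apply, neg_eq_zero] at h3
      simp only [LinearMap.neg_apply, LinearMap.comp_apply, map_neg, neg_eq_zero]
      exact ⟨e353, h3, Y.R_sq hY 5 _⟩
    · simp only [LinearMap.neg_apply, LinearMap.comp_apply, map_neg, neg_eq_zero]
      refine ⟨?_, Y.R_sq hY 4 _, ?_⟩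
      · rw [Y.R_triangle' hY (a := 3) (b := 4) (c := 0) (by decide), e353,
          Y.R_anticomm hY (a := 0) (b := 5) (by decide) (by decide),
          Y.R_triangle' hY (a := 0) (b := 3) (c := 4) (by decide), h4]
        simp only [map_sub, map_neg, map_zero, neg_zero, sub_zero, neg_neg, zero_sub]
        rw [Y.R_triangle' hY (a := 5) (b := 4) (c := 3) (by decide),
          Y.R_anticomm hY (a := 5) (b := 0) (by decide) (by decide), h5]
        simp [Y.R_sq hY]
      · rw [Y.R_triangle' hY (a := 5) (b := 4) (c := 3) (by decide), e353]
        simp [Y.R_sq hY]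

/-- The quartic relation is used in this block: on the common kernel of `R 3`, `R 4`, `R 5` all its
terms but `R 4 R 3 R 0 R 1` vanish, and `P_mem` in the top case needs that one to vanish as well. -/
lemma block_three : Block (Y.K {3, 4, 5}) (Y.K {2, 3, 4, 5}) 4 (Y.wordPrefix [2, 1, 0]) (fun
    | 0 => LinearMap.id
    | 1 => Y.R 2
    | 2 => -(Y.R 5 ∘ₗ Y.R 2)
    | _ => -(Y.R 4 ∘ₗ Y.R 5 ∘ₗ Y.R 2)) where
  pos := by norm_num
  P_zero := rfl
  mul_mem x hx l hl := by
    simp only [mem_K, Set.mem_insert_iff, Set.mem_singleton_iff, forall_eq_or_imp, forall_eq] at hx ⊢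
    interval_cases l <;> simp [wordPrefix, R_mul, hx, R_v, R_one, g_v, phiB_values]
  P_self x hx l hl := by
    simp only [mem_K, Set.mem_insert_iff, Set.mem_singleton_iff, forall_eq_or_imp, forall_eq] at hx
    interval_cases l <;> simp [wordPrefix, R_mul, hx, R_v, R_one, g_v, phiB_values]
  P_lt x hx l m hl hm := by
    simp only [mem_K, Set.mem_insert_iff, Set.mem_singleton_iff, forall_eq_or_imp, forall_eq] at hx
    interval_cases m <;> interval_cases l <;>
      simp [wordPrefix, R_mul, hx, R_v, R_one, g_v, phiB_values]
  P_mem x hx l hl h := by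
    simp only [mem_K, Set.mem_insert_iff, Set.mem_singleton_iff, forall_eq_or_imp, forall_eq] at hx ⊢
    obtain ⟨h3, h4, h5⟩ := hx
    have e42 : Y.R 4 (Y.R 2 x) = 0 := Y.R_anticomm_opposite hY (by decide) h4
    have e32 : Y.R 3 (Y.R 2 x) = 0 := by
      rw [Y.R_triangle' hY (a := 3) (b := 2) (c := 5) (by decide)]; simp [h3, h5]
    have e352 : Y.R 3 (Y.R 5 (Y.R 2 x)) = 0 := by
      rw [Y.R_triangle' hY (a := 3) (b := 5) (c := 4) (by decide)]; simp [e32, e42]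
    have e252 : Y.R 2 (Y.R 5 (Y.R 2 x)) = 0 := by
      rw [Y.R_triangle' hY (a := 2) (b := 5) (c := 3) (by decide)]; simp [e32, Y.R_sq hY]
    interval_cases l
    · exact ⟨h 1 (by norm_num) (by norm_num), h3, h4, h5⟩
    · have h2 := h 2 (by norm_num) (by norm_num)
      simp only [LinearMap.neg_apply, LinearMap.comp_apply, neg_eq_zero] at h2
      exact ⟨Y.R_sq hY 2 x, e32, e42, h2⟩
    · have h3 := h 3 (by norm_num) (by norm_num)
      simp only [LinearMap.neg_apply, LinearMap.comp_apply, neg_eq_zero] at h3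
      simp only [LinearMap.neg_apply, LinearMap.comp_apply, map_neg, neg_eq_zero]
      exact ⟨e252, e352, h3, Y.R_sq hY 5 _⟩
    · simp only [LinearMap.neg_apply, LinearMap.comp_apply, map_neg, neg_eq_zero]
      have e50 : Y.R 5 (Y.R 0 x) = 0 := Y.R_anticomm_opposite hY (by decide) h5
      have e40 : Y.R 4 (Y.R 0 x) = -Y.R 0 (Y.R 3 x) := by
        rw [Y.R_triangle' hY (a := 4) (b := 0) (c := 3) (by decide), h4]; simp
      have e430 : Y.R 4 (Y.R 3 (Y.R 0 x)) = 0 := by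
        rw [Y.R_triangle' hY (a := 4) (b := 3) (c := 5) (by decide), e50, e40, h3]; simp
      have q : Y.R 4 (Y.R 3 (Y.R 0 (Y.R 1 x))) = 0 := by
        have := Y.R_quartic hY x
        rw [e430, h3, h4] at this
        simpa using this
      have q' : Y.R 4 (Y.R 3 (Y.R 2 (Y.R 0 x))) = 0 := by
        rw [Y.R_triangle' hY (a := 2) (b := 0) (c := 1) (by decide)]
        simp only [map_sub, map_neg, q]
        rw [Y.R_anticomm hY (a := 3) (b := 1) (by decide) (by decide), e32]
        simp
      refine ⟨?_, ?_, Y.R_sq hY 4 _, ?_⟩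
      · rw [Y.R_anticomm hY (a := 2) (b := 4) (by decide) (by decide), e252]
        simp
      -- Quadratic relations reduce `R 3 R 4 R 5 R 2 x` to `R 4 R 3 R 2 R 0 x` up to sign, which is
      -- zero by `q'`.
      · rw [Y.R_triangle' hY (a := 3) (b := 4) (c := 0) (by decide), e352,
          Y.R_anticomm hY (a := 0) (b := 5) (by decide) (by decide),
          Y.R_triangle' hY (a := 0) (b := 2) (c := 3) (by decide), h3]
        simp only [map_sub, map_neg, map_zero, neg_zero, sub_zero, neg_neg, zero_sub]
        rw [Y.R_triangle' hY (a := 5) (b := 3) (c := 2) (by decide), e50]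
        simp [q']
      · rw [Y.R_triangle' hY (a := 5) (b := 4) (c := 3) (by decide), e352]
        simp [Y.R_sq hY]

lemma block_two : Block (Y.K {2, 3, 4, 5}) (Y.K {1, 2, 3, 4, 5}) 3 (Y.wordPrefix [1, 0]) (fun
    | 0 => LinearMap.id
    | 1 => Y.R 1
    | _ => -(Y.R 4 ∘ₗ Y.R 1)) where
  pos := by norm_num
  P_zero := rfl
  mul_mem x hx l hl := by
    simp only [mem_K, Set.mem_insert_iff, Set.mem_singleton_iff, forall_eq_or_imp, forall_eq] at hx ⊢
    interval_cases l <;> simp [wordPrefix, R_mul, hx, R_v, R_one, g_v, phiB_values]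
  P_self x hx l hl := by
    simp only [mem_K, Set.mem_insert_iff, Set.mem_singleton_iff, forall_eq_or_imp, forall_eq] at hx
    interval_cases l <;> simp [wordPrefix, R_mul, hx, R_v, R_one, g_v, phiB_values]
  P_lt x hx l m hl hm := by
    simp only [mem_K, Set.mem_insert_iff, Set.mem_singleton_iff, forall_eq_or_imp, forall_eq] at hx
    interval_cases m <;> interval_cases l <;>
      simp [wordPrefix, R_mul, hx, R_v, R_one, g_v, phiB_values]
  P_mem x hx l hl h := by
    simp only [mem_K, Set.mem_insert_iff, Set.mem_singleton_iff, forall_eq_or_imp, forall_eq] at hx ⊢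
    obtain ⟨h2, h3, h4, h5⟩ := hx
    have e31 : Y.R 3 (Y.R 1 x) = 0 := Y.R_anticomm_opposite hY (by decide) h3
    have e21 : Y.R 2 (Y.R 1 x) = 0 := by
      rw [Y.R_triangle' hY (a := 2) (b := 1) (c := 5) (by decide)]; simp [h2, h5]
    have e51 : Y.R 5 (Y.R 1 x) = 0 := by
      rw [Y.R_triangle' hY (a := 5) (b := 1) (c := 4) (by decide)]; simp [h4, h5]
    have e40 : Y.R 4 (Y.R 0 x) = 0 := by
      rw [Y.R_triangle' hY (a := 4) (b := 0) (c := 3) (by decide)]; simp [h3, h4]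
    interval_cases l
    · exact ⟨h 1 (by norm_num) (by norm_num), h2, h3, h4, h5⟩
    · have h2 := h 2 (by norm_num) (by norm_num)
      simp only [LinearMap.neg_apply, LinearMap.comp_apply, neg_eq_zero] at h2
      exact ⟨Y.R_sq hY 1 x, e21, e31, h2, e51⟩
    · simp only [LinearMap.neg_apply, LinearMap.comp_apply, map_neg, neg_eq_zero]
      refine ⟨?_, ?_, ?_, Y.R_sq hY 4 _, ?_⟩
      · rw [Y.R_triangle' hY (a := 1) (b := 4) (c := 5) (by decide), e51]
        simp [Y.R_sq hY]
      · rw [Y.R_anticomm hY (a := 2) (b := 4) (by decide) (by decide), e21]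
        simp
      · rw [Y.R_triangle' hY (a := 3) (b := 4) (c := 0) (by decide), e31,
          Y.R_triangle' hY (a := 0) (b := 1) (c := 2) (by decide), h2]
        simp only [map_sub, map_neg, map_zero, neg_zero, sub_zero, neg_neg, zero_sub]
        rw [Y.R_anticomm hY (a := 4) (b := 2) (by decide) (by decide), e40]
        simp
      · rw [Y.R_triangle' hY (a := 5) (b := 4) (c := 3) (by decide), e31, e51]
        simp

lemma block_one : Block (Y.K {1, 2, 3, 4, 5}) (Y.K {0, 1, 2, 3, 4, 5}) 2 (Y.wordPrefix [0]) (fun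
    | 0 => LinearMap.id
    | _ => Y.R 0) where
  pos := by norm_num
  P_zero := rfl
  mul_mem x hx l hl := by
    simp only [mem_K, Set.mem_insert_iff, Set.mem_singleton_iff, forall_eq_or_imp, forall_eq] at hx ⊢
    interval_cases l <;> simp [wordPrefix, R_mul, hx, R_v, R_one, g_v, phiB_values]
  P_self x hx l hl := by
    simp only [mem_K, Set.mem_insert_iff, Set.mem_singleton_iff, forall_eq_or_imp, forall_eq] at hx
    interval_cases l <;> simp [wordPrefix, R_mul, hx, R_v, R_one, g_v, phiB_values]
  P_lt x hx l m hl hm := by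
    simp only [mem_K, Set.mem_insert_iff, Set.mem_singleton_iff, forall_eq_or_imp, forall_eq] at hx
    interval_cases m <;> interval_cases l <;>
      simp [wordPrefix, R_mul, hx, R_v, R_one, g_v, phiB_values]
  P_mem x hx l hl h := by
    simp only [mem_K, Set.mem_insert_iff, Set.mem_singleton_iff, forall_eq_or_imp, forall_eq] at hx ⊢
    obtain ⟨h1, h2, h3, h4, h5⟩ := hx
    interval_cases l
    · exact ⟨h 1 (by norm_num) (by norm_num), h1, h2, h3, h4, h5⟩
    · change Y.R 0 (Y.R 0 x) = 0 ∧ Y.R 1 (Y.R 0 x) = 0 ∧ Y.R 2 (Y.R 0 x) = 0 ∧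
        Y.R 3 (Y.R 0 x) = 0 ∧ Y.R 4 (Y.R 0 x) = 0 ∧ Y.R 5 (Y.R 0 x) = 0
      refine ⟨Y.R_sq hY 0 x, ?_, ?_, ?_, ?_, Y.R_anticomm_opposite hY (by decide) h5⟩
      · rw [Y.R_triangle' hY (a := 1) (b := 0) (c := 4) (by decide)]; simp [h1, h4]
      · rw [Y.R_triangle' hY (a := 2) (b := 0) (c := 1) (by decide)]; simp [h1, h2]
      · rw [Y.R_triangle' hY (a := 3) (b := 0) (c := 2) (by decide)]; simp [h2, h3]
      · rw [Y.R_triangle' hY (a := 4) (b := 0) (c := 3) (by decide)]; simp [h3, h4]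

end SkewSystem

end Nichols

/-! ### Normal words -/

namespace Nichols

/-- The index set of the normal words: prefixes of the words `1`, `21`, `321`, `432`, `54`, `6`. -/
abbrev NormalIndex : Type := (((((Unit × Fin 2) × Fin 3) × Fin 4) × Fin 4) × Fin 3) × Fin 2

/-- The degree of a normal word. -/
def NormalIndex.degree (x : NormalIndex) : ℕ :=
  0 + (x.1.1.1.1.1.2 : ℕ) + (x.1.1.1.1.2 : ℕ) + (x.1.1.1.2 : ℕ) + (x.1.1.2 : ℕ) + (x.1.2 : ℕ) +
    (x.2 : ℕ)

namespace SkewSystem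

variable {k B : Type*} [Field k] [Ring B] [Algebra k B] (Y : SkewSystem k B)

/-- The normal words. -/
def normalWord (x : NormalIndex) : B :=
  -- The leading `1` is the starting family of the iteration, so that the word has literally the
  -- nested form produced by `Block`.
  1 * Y.wordPrefix [0] x.1.1.1.1.1.2 * Y.wordPrefix [1, 0] x.1.1.1.1.2 *
    Y.wordPrefix [2, 1, 0] x.1.1.1.2 * Y.wordPrefix [3, 2, 1] x.1.1.2 *
    Y.wordPrefix [4, 3] x.1.2 * Y.wordPrefix [5] x.2

variable (hY : Algebra.adjoin k (Set.range Y.v) = ⊤)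
include hY

theorem normalWord_linearIndependent [Nontrivial B] : LinearIndependent k Y.normalWord := by
  have h0 : LinearIndependent k (fun _ : Unit => (1 : B)) :=
    LinearIndependent.of_subsingleton () one_ne_zero
  have m0 : ∀ i : Unit, (fun _ : Unit => (1 : B)) i ∈ Y.K {0, 1, 2, 3, 4, 5} :=
    fun i s _ => Y.R_one s
  have h1 := (Y.block_one hY).linearIndependent _ h0 m0
  have m1 := fun i : Unit × Fin 2 => (Y.block_one hY).mul_mem _ (m0 i.1) i.2 i.2.2
  have h2 := (Y.block_two hY).linearIndependent _ h1 m1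
  have m2 := fun i : _ × Fin 3 => (Y.block_two hY).mul_mem _ (m1 i.1) i.2 i.2.2
  have h3 := (Y.block_three hY).linearIndependent _ h2 m2
  have m3 := fun i : _ × Fin 4 => (Y.block_three hY).mul_mem _ (m2 i.1) i.2 i.2.2
  have h4 := (Y.block_four hY).linearIndependent _ h3 m3
  have m4 := fun i : _ × Fin 4 => (Y.block_four hY).mul_mem _ (m3 i.1) i.2 i.2.2
  have h5 := (Y.block_five hY).linearIndependent _ h4 m4
  have m5 := fun i : _ × Fin 3 => (Y.block_five hY).mul_mem _ (m4 i.1) i.2 i.2.2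
  exact (Y.block_six hY).linearIndependent _ h5 m5

/-- Independence holds in any non-zero algebra generated by the `v i` of a skew system. Spanning
needs in addition that only scalars are killed by all `R i`, which is special to the Nichols
algebra. -/
theorem normalWord_span
    (hK : Y.K {0, 1, 2, 3, 4, 5} ≤ Submodule.span k (Set.range fun _ : Unit => (1 : B))) :
    ⊤ ≤ Submodule.span k (Set.range Y.normalWord) := by
  have h1 := (Y.block_one hY).span _ hK
  have h2 := (Y.block_two hY).span _ h1
  have h3 := (Y.block_three hY).span _ h2
  have h4 := (Y.block_four hY).span _ h3
  have h5 := (Y.block_five hY).span _ h4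
  have h6 := (Y.block_six hY).span _ h5
  intro x _
  exact h6 (by simp [mem_K])

end SkewSystem

/-! ### The grading of the Nichols algebra -/

variable {k V : Type*} [Field k] [AddCommGroup V] [Module k V]
variable (c : V ⊗[k] V →ₗ[k] V ⊗[k] V)

instance : Nontrivial (NicholsAlgebra c) := (counit c).toRingHom.domain_nontrivial

lemma homogeneous_zero : homogeneous c 0 = 1 := pow_zero _

lemma homogeneous_mul_mem {m n : ℕ} {x y : NicholsAlgebra c} (hx : x ∈ homogeneous c m)
    (hy : y ∈ homogeneous c n) : x * y ∈ homogeneous c (m + n) := by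
  rw [homogeneous, pow_add]; exact Submodule.mul_mem_mul hx hy

lemma ι_mem_homogeneous (w : V) : ι c w ∈ homogeneous c 1 := by
  rw [homogeneous, pow_one]; exact ⟨w, rfl⟩

lemma counit_ι (w : V) : counit c (ι c w) = 0 := by
  simp [counit, ι, TensorAlgebra.algebraMapInv]

section Basis

variable (v : Module.Basis (Fin 6) k V)
include v

variable {c} in
/-- Left induction on the Nichols algebra of a module with a basis. -/
theorem nichols_induction_left {P : NicholsAlgebra c → Prop} (one : P 1)
    (add : ∀ x y, P x → P y → P (x + y)) (smul : ∀ (r : k) x, P x → P (r • x))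
    (mul : ∀ i x, P x → P (ι c (v i) * x)) (x : NicholsAlgebra c) : P x := by
  obtain ⟨y, rfl⟩ := RingQuot.mkAlgHom_surjective k (Rel c) x
  induction y using tensorAlgebra_induction_left v with
  | one => simpa using one
  | add x y hx hy => simpa using add _ _ hx hy
  | smul r x hx => simpa using smul r _ hx
  | mul i x hx => rw [map_mul]; exact mul i _ hx

lemma adjoin_ι_eq_top : Algebra.adjoin k (Set.range fun i => ι c (v i)) = ⊤ := by
  rw [eq_top_iff]
  intro x _
  induction x using nichols_induction_left v with
  | one => exact one_mem _
  | add x y hx hy => exact add_mem (hx trivial) (hy trivial)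
  | smul r x hx => exact Subalgebra.smul_mem _ (hx trivial) r
  | mul i x hx => exact mul_mem (Algebra.subset_adjoin ⟨i, rfl⟩) (hx trivial)

lemma iSup_homogeneous : ⨆ n, homogeneous c n = ⊤ := by
  rw [eq_top_iff]
  intro x _
  induction x using nichols_induction_left v with
  | one => exact Submodule.mem_iSup_of_mem 0 (by rw [homogeneous_zero]; exact Submodule.one_le.1 le_rfl)
  | add x y hx hy => exact add_mem (hx trivial) (hy trivial)
  | smul r x hx => exact Submodule.smul_mem _ r (hx trivial)
  | mul i x hx =>
    replace hx := hx trivial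
    induction hx using Submodule.iSup_induction' with
    | mem n x hx =>
      exact Submodule.mem_iSup_of_mem (1 + n) (homogeneous_mul_mem c (ι_mem_homogeneous c _) hx)
    | zero => simp
    | add x y _ _ h1 h2 => rw [mul_add]; exact add_mem (h1 trivial) (h2 trivial)

lemma lift_monomial (n : ℕ) (x : TensorAlgebra k V)
    (hx : x ∈ LinearMap.range (TensorAlgebra.ι k : V →ₗ[k] TensorAlgebra k V) ^ n) :
    TensorAlgebra.lift k ((LinearMap.restrictScalars k
      (Polynomial.monomial (R := NicholsAlgebra c) 1)) ∘ₗ ι c) x =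
      Polynomial.monomial n (RingQuot.mkAlgHom k (Rel c) x) := by
  revert x
  refine tensorPower_induction_left v (P := fun n x => TensorAlgebra.lift k
    ((LinearMap.restrictScalars k (Polynomial.monomial (R := NicholsAlgebra c) 1)) ∘ₗ ι c) x =
      Polynomial.monomial n (RingQuot.mkAlgHom k (Rel c) x)) ?_ ?_ ?_ ?_ ?_ n
  · simp
  · simp
  · intro n x y h1 h2; simp only [map_add, h1, h2]
  · intro n r x h; rw [map_smul, map_smul, h, Polynomial.smul_monomial]
  · intro n i x _ h
    rw [map_mul, h, TensorAlgebra.lift_ι_apply, map_mul]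
    simp [ι, Polynomial.monomial_mul_monomial, add_comm]

/-- The algebra map `𝔅(V) → 𝔅(V)[X]` which is `x ↦ x Xⁿ` in degree `n`. -/
def degreeMap : NicholsAlgebra c →ₐ[k] Polynomial (NicholsAlgebra c) :=
  RingQuot.liftAlgHom k ⟨TensorAlgebra.lift k ((LinearMap.restrictScalars k
      (Polynomial.monomial (R := NicholsAlgebra c) 1)) ∘ₗ ι c), by
    rintro x _ ⟨n, hx, hs, rfl⟩
    have h0 : RingQuot.mkAlgHom k (Rel c) x = 0 := by
      rw [← map_zero (RingQuot.mkAlgHom k (Rel c))]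
      exact RingQuot.mkAlgHom_rel k ⟨n, hx, hs, rfl⟩
    rw [lift_monomial c v n x hx, h0, map_zero, map_zero]⟩

lemma degreeMap_of_mem {n : ℕ} {x : NicholsAlgebra c} (hx : x ∈ homogeneous c n) :
    degreeMap c v x = Polynomial.monomial n x := by
  rw [← map_range_pow] at hx
  obtain ⟨y, hy, rfl⟩ := hx
  rw [degreeMap]
  erw [RingQuot.liftAlgHom_mkAlgHom_apply]
  exact lift_monomial c v n y hy

/-- The projection onto the homogeneous component of degree `n`. -/
def proj (n : ℕ) : NicholsAlgebra c →ₗ[k] NicholsAlgebra c where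
  toFun x := (degreeMap c v x).coeff n
  map_add' x y := by simp
  map_smul' r x := by simp

lemma proj_of_mem {m n : ℕ} {x : NicholsAlgebra c} (hx : x ∈ homogeneous c m) :
    proj c v n x = if m = n then x else 0 := by
  change (degreeMap c v x).coeff n = _
  rw [degreeMap_of_mem c v hx, Polynomial.coeff_monomial]

variable {c} in
theorem nichols_induction_homogeneous {P : NicholsAlgebra c → Prop} (zero : P 0)
    (add : ∀ x y, P x → P y → P (x + y)) (mem : ∀ n, ∀ x ∈ homogeneous c n, P x)
    (x : NicholsAlgebra c) : P x := by
  have hx : x ∈ ⨆ n, homogeneous c n := by rw [iSup_homogeneous c v]; trivial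
  exact Submodule.iSup_induction _ (motive := P) hx mem zero add

lemma proj_mem (n : ℕ) (x : NicholsAlgebra c) : proj c v n x ∈ homogeneous c n := by
  induction x using nichols_induction_homogeneous v with
  | zero => simp
  | add x y hx hy => rw [map_add]; exact add_mem hx hy
  | mem m x hx =>
    rw [proj_of_mem c v hx]
    split_ifs with h
    · exact h ▸ hx
    · exact zero_mem _

lemma eq_proj_zero (x : NicholsAlgebra c) (h : ∀ n, proj c v (n + 1) x = 0) :
    x = proj c v 0 x := by
  -- Setting `X = 1` adds up the homogeneous components.
  have key : ∀ y, (degreeMap c v y).eval 1 = y := by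
    intro y
    induction y using nichols_induction_homogeneous v with
    | zero => simp
    | add x y hx hy => rw [map_add, Polynomial.eval_add, hx, hy]
    | mem m x hx => rw [degreeMap_of_mem c v hx, Polynomial.eval_monomial]; simp
  have h2 : degreeMap c v x = Polynomial.C (proj c v 0 x) := by
    ext n
    rw [Polynomial.coeff_C]
    cases n with
    | zero => rfl
    | succ n => exact h n
  conv_lhs => rw [← key x, h2, Polynomial.eval_C]

end Basis

/-! ### The basis of normal words, the Hilbert series and the integral -/

section Braided

variable (v : Module.Basis (Fin 6) k V)
variable {c} (hc : ∀ i j, c (v i ⊗ₜ v j) = -(v (phiB i j) ⊗ₜ v i))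
include hc

lemma proj_R (n : ℕ) (j : Fin 6) (x : NicholsAlgebra c) :
    (nicholsSystem v hc).R j (proj c v (n + 1) x) = proj c v n ((nicholsSystem v hc).R j x) := by
  induction x using nichols_induction_homogeneous v with
  | zero => simp
  | add x y hx hy => simp only [map_add, hx, hy]
  | mem m x hx =>
    rw [proj_of_mem c v hx]
    cases m with
    | zero =>
      rw [homogeneous_zero] at hx
      obtain ⟨r, rfl⟩ := Submodule.mem_one.1 hx
      simp [SkewSystem.R_algebraMap]
    | succ m =>
      rw [proj_of_mem c v (nicholsSystem_R_mem v hc m j x hx)]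
      by_cases h : m = n <;> simp [h]

/-- Derivations lower the degree by one, so each homogeneous component of a common zero is again a
common zero, and those of positive degree vanish. -/
lemma K_univ_le : (nicholsSystem v hc).K {0, 1, 2, 3, 4, 5} ≤
    Submodule.span k (Set.range fun _ : Unit => (1 : NicholsAlgebra c)) := by
  intro x hx
  have hx' : ∀ j, (nicholsSystem v hc).R j x = 0 := fun j => hx j (by fin_cases j <;> simp)
  rw [eq_proj_zero c v x fun n => eq_zero_of_R_eq_zero v hc n _ (proj_mem c v _ x) fun j => by
    rw [proj_R, hx', map_zero]]
  have h := proj_mem c v 0 x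
  rw [homogeneous_zero] at h
  obtain ⟨r, hr⟩ := Submodule.mem_one.1 h
  rw [← hr, Algebra.algebraMap_eq_smul_one]
  exact Submodule.smul_mem _ _ (Submodule.subset_span ⟨(), rfl⟩)

lemma nicholsSystem_adjoin : Algebra.adjoin k (Set.range (nicholsSystem v hc).v) = ⊤ :=
  adjoin_ι_eq_top c v

/-- The basis of the Nichols algebra consisting of the normal words. -/
def normalBasis : Module.Basis NormalIndex k (NicholsAlgebra c) :=
  Module.Basis.mk ((nicholsSystem v hc).normalWord_linearIndependent (nicholsSystem_adjoin v hc))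
    ((nicholsSystem v hc).normalWord_span (nicholsSystem_adjoin v hc) (K_univ_le v hc))

lemma normalBasis_apply (x : NormalIndex) :
    normalBasis v hc x = (nicholsSystem v hc).normalWord x := by
  simp [normalBasis]

lemma wordPrefix_mem (w : List (Fin 6)) (l : ℕ) (hl : l ≤ w.length) :
    (nicholsSystem v hc).wordPrefix w l ∈ homogeneous c l := by
  have h : ∀ u : List (Fin 6), (u.map (nicholsSystem v hc).v).prod ∈ homogeneous c u.length := by
    intro u
    induction u with
    | nil => rw [List.length_nil, homogeneous_zero]; exact Submodule.one_le.1 le_rfl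
    | cons a u ih =>
      rw [List.map_cons, List.prod_cons, List.length_cons, add_comm]
      exact homogeneous_mul_mem c (ι_mem_homogeneous c _) ih
  have := h (w.take l)
  rwa [List.length_take, min_eq_left hl] at this

lemma normalBasis_mem (x : NormalIndex) : normalBasis v hc x ∈ homogeneous c x.degree := by
  rw [normalBasis_apply]
  refine homogeneous_mul_mem c (homogeneous_mul_mem c (homogeneous_mul_mem c
    (homogeneous_mul_mem c (homogeneous_mul_mem c (homogeneous_mul_mem c ?_ ?_) ?_) ?_) ?_) ?_) ?_
  · rw [homogeneous_zero]; exact Submodule.one_le.1 le_rfl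
  all_goals exact wordPrefix_mem v hc _ _ (Nat.le_of_lt_succ (Fin.is_lt _))

lemma homogeneous_eq_span (n : ℕ) : homogeneous c n =
    Submodule.span k (Set.range fun x : {x : NormalIndex // x.degree = n} =>
      normalBasis v hc x) := by
  apply le_antisymm
  · intro x hx
    have h1 : proj c v n x = x := by rw [proj_of_mem c v hx, if_pos rfl]
    have h2 := congrArg (proj c v n) ((normalBasis v hc).sum_repr x)
    rw [h1, map_sum] at h2
    rw [← h2]
    refine Submodule.sum_mem _ fun i _ => ?_
    rw [map_smul, proj_of_mem c v (normalBasis_mem v hc i)]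
    refine Submodule.smul_mem _ _ ?_
    split_ifs with h
    · exact Submodule.subset_span ⟨⟨i, h⟩, rfl⟩
    · exact zero_mem _
  · rw [Submodule.span_le]
    rintro _ ⟨⟨i, rfl⟩, rfl⟩
    exact normalBasis_mem v hc i

lemma finrank_homogeneous (n : ℕ) :
    Module.finrank k (homogeneous c n) = Fintype.card {x : NormalIndex // x.degree = n} := by
  rw [homogeneous_eq_span v hc n]
  exact finrank_span_eq_card
    ((normalBasis v hc).linearIndependent.comp _ Subtype.val_injective)

theorem rank_nicholsAlgebra : Module.rank k (NicholsAlgebra c) = 576 := by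
  rw [rank_eq_card_basis (normalBasis v hc)]
  simp

omit hc in
omit [Field k] [AddCommGroup V] [Module k V] in
lemma sum_X_pow_prod {I : Type*} [Fintype I] (d : I → ℕ) (n : ℕ) :
    ∑ x : I × Fin n, (PowerSeries.X : PowerSeries ℤ) ^ (d x.1 + (x.2 : ℕ)) =
      (∑ i, PowerSeries.X ^ d i) * qNumber n := by
  rw [qNumber, Finset.sum_range, Fintype.sum_prod_type, Finset.sum_mul]
  simp only [pow_add, Finset.mul_sum]

omit hc in
omit [Field k] [AddCommGroup V] [Module k V] in
lemma sum_X_pow_degree : ∑ x : NormalIndex, (PowerSeries.X : PowerSeries ℤ) ^ x.degree =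
    qNumber 2 ^ 2 * qNumber 3 ^ 2 * qNumber 4 ^ 2 := by
  unfold NormalIndex.degree
  rw [sum_X_pow_prod (fun x : (((((Unit × Fin 2) × Fin 3) × Fin 4) × Fin 4) × Fin 3) => 0 + (x.1.1.1.1.2 : ℕ) + (x.1.1.1.2 : ℕ) + (x.1.1.2 : ℕ) + (x.1.2 : ℕ) + (x.2 : ℕ)),
    sum_X_pow_prod (fun x : ((((Unit × Fin 2) × Fin 3) × Fin 4) × Fin 4) => 0 + (x.1.1.1.2 : ℕ) + (x.1.1.2 : ℕ) + (x.1.2 : ℕ) + (x.2 : ℕ)),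
    sum_X_pow_prod (fun x : (((Unit × Fin 2) × Fin 3) × Fin 4) => 0 + (x.1.1.2 : ℕ) + (x.1.2 : ℕ) + (x.2 : ℕ)),
    sum_X_pow_prod (fun x : ((Unit × Fin 2) × Fin 3) => 0 + (x.1.2 : ℕ) + (x.2 : ℕ)),
    sum_X_pow_prod (fun x : (Unit × Fin 2) => 0 + (x.2 : ℕ)),
    sum_X_pow_prod (fun x : Unit => 0)]
  simp only [Finset.univ_unique, Finset.sum_const, Finset.card_singleton, pow_zero, one_smul]
  ring

theorem hilbertSeries_eq :
    hilbertSeries c = qNumber 2 ^ 2 * qNumber 3 ^ 2 * qNumber 4 ^ 2 := by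
  rw [← sum_X_pow_degree]
  ext n
  simp only [hilbertSeries, PowerSeries.coeff_mk, map_sum, PowerSeries.coeff_X_pow,
    finrank_homogeneous v hc n, Fintype.card_subtype, Finset.card_filter, Nat.cast_sum]
  exact Finset.sum_congr rfl fun x _ => by simp only [eq_comm (a := n)]; split_ifs <;> simp

lemma homogeneous_eq_bot {n : ℕ} (hn : 12 < n) : homogeneous c n = ⊥ := by
  rw [homogeneous_eq_span v hc n, Submodule.span_eq_bot]
  rintro _ ⟨⟨⟨⟨⟨⟨⟨⟨_, a⟩, b⟩, d⟩, e⟩, f⟩, g⟩, h⟩, rfl⟩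
  simp only [NormalIndex.degree] at h
  omega

omit hc in
lemma isIntegral_smul {r : k} (hr : r ≠ 0) {x : NicholsAlgebra c} (hx : IsIntegral c x) :
    IsIntegral c (r • x) :=
  ⟨smul_ne_zero hr hx.1, fun y => by
    rw [mul_smul_comm, smul_mul_assoc, (hx.2 y).1, (hx.2 y).2, smul_comm]; exact ⟨rfl, rfl⟩⟩

/-- The word is a basis vector, hence non-zero, and has the top degree `1 + 2 + 3 + 3 + 2 + 1 = 12`;
multiplying it by a letter lands in degree 13, which is zero. -/
theorem isIntegral_topWord : IsIntegral c
    (([0, 1, 0, 2, 1, 0, 3, 2, 1, 4, 3, 5] : List (Fin 6)).map fun i => ι c (v i)).prod := by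
  have h : (([0, 1, 0, 2, 1, 0, 3, 2, 1, 4, 3, 5] : List (Fin 6)).map fun i => ι c (v i)).prod =
      normalBasis v hc (((((((), 1), 2), 3), 3), 2), 1) := by
    rw [normalBasis_apply]
    simp [SkewSystem.normalWord, SkewSystem.wordPrefix, nicholsSystem, mul_assoc]
  have hm := normalBasis_mem v hc (((((((), 1), 2), 3), 3), 2), 1)
  change _ ∈ homogeneous c 12 at hm
  rw [h]
  refine ⟨(normalBasis v hc).ne_zero _, fun x => ?_⟩
  generalize normalBasis v hc (((((((), 1), 2), 3), 3), 2), 1) = Λ at hm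
  have h1 : ∀ i, ι c (v i) * Λ = 0 := fun i => by
    have := homogeneous_mul_mem c (ι_mem_homogeneous c (v i)) hm
    rwa [homogeneous_eq_bot v hc (by norm_num), Submodule.mem_bot] at this
  have h2 : ∀ i, Λ * ι c (v i) = 0 := fun i => by
    have := homogeneous_mul_mem c hm (ι_mem_homogeneous c (v i))
    rwa [homogeneous_eq_bot v hc (by norm_num), Submodule.mem_bot] at this
  induction x using nichols_induction_left v with
  | one => simp
  | add x y hx hy => simp [add_mul, mul_add, hx, hy, add_smul]
  | smul r x hx => simp [hx, mul_smul]
  | mul i x hx =>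
    rw [mul_assoc, hx.1, mul_smul_comm, h1, ← mul_assoc, h2, map_mul, counit_ι]
    simp

theorem rank_homogeneous_two : Module.rank k (homogeneous c 2) = 19 := by
  have : Module.Finite k (NicholsAlgebra c) := Module.Finite.of_basis (normalBasis v hc)
  rw [← Module.finrank_eq_rank, finrank_homogeneous v hc 2]
  have : Fintype.card {x : NormalIndex // x.degree = 2} = 19 := by
    rw [Fintype.card_subtype]
    decide +kernel
  rw [this]
  rfl

end Braided

end Nichols

/-! ### The degree two part for an arbitrary braiding -/

namespace Nichols

variable {k V : Type*} [Field k] [AddCommGroup V] [Module k V]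
variable (c : V ⊗[k] V →ₗ[k] V ⊗[k] V)

section DegreeTwo

/-- The tensor square as the degree two part of the tensor algebra. -/
def squareMul : V ⊗[k] V →ₗ[k] TensorAlgebra k V :=
  leftMul ∘ₗ (TensorAlgebra.ι k).lTensor V

lemma squareMul_tmul (x y : V) :
    squareMul (x ⊗ₜ[k] y) = TensorAlgebra.ι k x * TensorAlgebra.ι k y := by
  simp [squareMul, leftMul_tmul]

lemma squareMul_injective : Function.Injective (squareMul (k := k) (V := V)) := by
  refine leftMul_injective.comp (Module.Flat.lTensor_preserves_injective_linearMap _ ?_)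
  exact TensorAlgebra.ι_leftInverse.injective

lemma symmetrizer_one_ι (x : V) : symmetrizer c 1 (TensorAlgebra.ι k x) = TensorAlgebra.ι k x := by
  have h := shuffle_ι_mul c x 1
  rw [mul_one, shuffle_one] at h
  simp [symmetrizer, h, leftMul_tmul]

lemma symmetrizer_two_squareMul (z : V ⊗[k] V) :
    symmetrizer c 2 (squareMul z) = squareMul (z + c z) := by
  have hp : ∀ t : V ⊗[k] V, (symmetrizer c 1).lTensor V (leftMul.lTensor V
      (TensorProduct.assoc k V V _ (t ⊗ₜ (1 : TensorAlgebra k V)))) =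
      (TensorAlgebra.ι k).lTensor V t := by
    intro t
    induction t using TensorProduct.induction_on with
    | zero => simp
    | tmul a b => simp [leftMul_tmul, symmetrizer_one_ι]
    | add a b ha hb => simp only [TensorProduct.add_tmul, map_add, ha, hb]
  induction z using TensorProduct.induction_on with
  | zero => simp
  | add a b ha hb => rw [map_add, map_add, ha, hb, ← map_add, map_add c]; congr 1; abel
  | tmul x y =>
    have hy := shuffle_ι_mul c y 1
    rw [mul_one, shuffle_one, TensorProduct.tmul_zero, map_zero, add_zero] at hy
    rw [squareMul_tmul, symmetrizer, LinearMap.comp_apply, LinearMap.comp_apply, shuffle_ι_mul, hy,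
      map_add, LinearMap.lTensor_tmul, symmetrizer_one_ι]
    have h2 : (symmetrizer c 1).lTensor V (push c (x ⊗ₜ (y ⊗ₜ (1 : TensorAlgebra k V)))) =
        (TensorAlgebra.ι k).lTensor V (c (x ⊗ₜ y)) := by
      rw [← hp]; simp [push]
    rw [h2, map_add, map_add, leftMul_tmul, squareMul_tmul]
    rfl

/-- The action of a vector on the truncation `k ⊕ V ⊕ V ⊗ V`, where the multiplication
`V ⊗ V → V ⊗ V` is `1 + c`. -/
def truncAct : V →ₗ[k] Module.End k (k × V × (V ⊗[k] V)) :=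
  LinearMap.mk₂ k (fun w p => (0, p.1 • w, w ⊗ₜ p.2.1 + c (w ⊗ₜ p.2.1)))
    (fun a b p => by
      simp only [Prod.mk_add_mk, smul_add, TensorProduct.add_tmul, map_add, add_zero]
      congr 2; abel)
    (fun r a p => by
      simp only [Prod.smul_mk, smul_zero, ← TensorProduct.smul_tmul', map_smul, smul_add,
        smul_comm r])
    (fun a p q => by
      simp only [Prod.mk_add_mk, Prod.fst_add, Prod.snd_add, add_smul, TensorProduct.tmul_add,
        map_add, add_zero]
      congr 2; abel)
    (fun r a p => by
      simp only [Prod.smul_mk, Prod.smul_fst, Prod.smul_snd, smul_zero, TensorProduct.tmul_smul,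
        map_smul, smul_add, smul_assoc])

lemma truncAct_apply (w : V) (p : k × V × (V ⊗[k] V)) :
    truncAct c w p = (0, p.1 • w, w ⊗ₜ p.2.1 + c (w ⊗ₜ p.2.1)) := rfl

lemma truncAct_squareMul (z : V ⊗[k] V) (p : k × V × (V ⊗[k] V)) :
    TensorAlgebra.lift k (truncAct c) (squareMul z) p = (0, 0, p.1 • (z + c z)) := by
  induction z using TensorProduct.induction_on with
  | zero => simp; rfl
  | add a b ha hb =>
    simp only [map_add, LinearMap.add_apply, ha, hb, Prod.mk_add_mk, add_zero, ← smul_add]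
    congr 3; abel
  | tmul x y => simp [squareMul_tmul, truncAct_apply]

lemma range_sq : LinearMap.range (TensorAlgebra.ι k : V →ₗ[k] TensorAlgebra k V) ^ 2 =
    LinearMap.range (squareMul (k := k) (V := V)) := by
  apply le_antisymm
  · rw [pow_two, Submodule.mul_le]
    rintro _ ⟨x, rfl⟩ _ ⟨y, rfl⟩
    exact ⟨x ⊗ₜ y, squareMul_tmul x y⟩
  · rintro _ ⟨z, rfl⟩
    induction z using TensorProduct.induction_on with
    | zero => simp
    | add a b ha hb => rw [map_add]; exact add_mem ha hb
    | tmul x y =>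
      rw [squareMul_tmul, pow_two]; exact Submodule.mul_mem_mul ⟨x, rfl⟩ ⟨y, rfl⟩

/-- After two letters only the last summand `V ⊗ V` survives, and a third letter kills it. Relations
of degree at least three are therefore harmless for `truncMap`. -/
lemma lift_truncAct_eq_zero {n : ℕ} (hn : 3 ≤ n) {x : TensorAlgebra k V}
    (hx : x ∈ LinearMap.range (TensorAlgebra.ι k : V →ₗ[k] TensorAlgebra k V) ^ n) :
    TensorAlgebra.lift k (truncAct c) x = 0 := by
  obtain ⟨m, rfl⟩ := Nat.exists_eq_add_of_le' hn
  rw [show m + 3 = m + 1 + 2 from rfl, pow_add, range_sq, pow_succ] at hx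
  induction hx using Submodule.mul_induction_on' with
  | add a _ b _ ha hb => rw [map_add, ha, hb, add_zero]
  | mem_mul_mem a ha b hb =>
    obtain ⟨z, rfl⟩ := hb
    induction ha using Submodule.mul_induction_on' with
    | add a _ b _ ha hb => rw [add_mul, map_add, ha, hb, add_zero]
    | mem_mul_mem a _ b hb =>
      obtain ⟨w, rfl⟩ := hb
      refine LinearMap.ext fun p => ?_
      simp [truncAct_squareMul, truncAct_apply, ← Prod.zero_eq_mk]

/-- The truncation of the Nichols algebra in degrees at most two. -/
def truncMap : NicholsAlgebra c →ₐ[k] Module.End k (k × V × (V ⊗[k] V)) :=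
  RingQuot.liftAlgHom k ⟨TensorAlgebra.lift k (truncAct c), by
    rintro x _ ⟨n, hx, hs, rfl⟩
    rw [map_zero]
    match n, hx, hs with
    | 0, hx, hs =>
      have : x = 0 := hs
      rw [this, map_zero]
    | 1, hx, hs =>
      rw [pow_one] at hx
      obtain ⟨w, rfl⟩ := hx
      rw [symmetrizer_one_ι] at hs
      rw [hs, map_zero]
    | 2, hx, hs =>
      rw [range_sq] at hx
      obtain ⟨z, rfl⟩ := hx
      rw [symmetrizer_two_squareMul, map_eq_zero_iff _ squareMul_injective] at hs
      refine LinearMap.ext fun p => ?_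
      rw [truncAct_squareMul, hs, smul_zero]
      rfl
    | n + 3, hx, hs => exact lift_truncAct_eq_zero c (by omega) hx⟩

/-- Acting on the vector `(1, 0, 0)` of the truncation sends the class of `z` in degree two to `z +
c z`, so `𝔅₂` maps onto the range of `1 + c`. -/
lemma finrank_range_le {n : ℕ} (hn : Module.rank k (homogeneous c 2) ≤ n) :
    Module.finrank k (LinearMap.range (LinearMap.id + c)) ≤ n := by
  let F : NicholsAlgebra c →ₗ[k] V ⊗[k] V :=
    LinearMap.snd k V (V ⊗[k] V) ∘ₗ LinearMap.snd k k (V × (V ⊗[k] V)) ∘ₗ LinearMap.applyₗ (R := k) ((1, 0, 0) : k × V × (V ⊗[k] V)) ∘ₗ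
      (truncMap c).toLinearMap
  have hF : ∀ z, F (RingQuot.mkAlgHom k (Rel c) (squareMul z)) = z + c z := by
    intro z
    simp only [F, LinearMap.comp_apply, AlgHom.toLinearMap_apply, truncMap]
    erw [RingQuot.liftAlgHom_mkAlgHom_apply]
    simp [truncAct_squareMul]
  have h : LinearMap.range (LinearMap.id + c) ≤ (homogeneous c 2).map F := by
    rintro _ ⟨z, rfl⟩
    refine ⟨_, ?_, hF z⟩
    rw [← map_range_pow, range_sq]
    exact ⟨_, ⟨z, rfl⟩, rfl⟩
  have h1 := (Cardinal.lift_le.2 (Submodule.rank_mono h)).trans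
    ((lift_rank_map_le F _).trans (Cardinal.lift_le.2 hn))
  rw [Cardinal.lift_natCast] at h1
  exact Module.finrank_le_of_rank_le (Cardinal.lift_le_nat_iff.1 h1)

end DegreeTwo

/-! ### The eigenvalue -1 of the braiding, orbit by orbit -/

section Kernel

/-- Representatives of the orbits of `(i, j) ↦ (i ▷ j, i)` of length one. -/
def orbitOne (i : Fin 6) : Fin 6 × Fin 6 := (i, i)

/-- Representatives of the orbits of `(i, j) ↦ (i ▷ j, i)` of length two. -/
def orbitTwo : Fin 3 → Fin 6 × Fin 6 := ![(0, 5), (1, 3), (2, 4)]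

/-- Representatives of the orbits of `(i, j) ↦ (i ▷ j, i)` of length three. -/
def orbitThree : Fin 8 → Fin 6 × Fin 6 :=
  ![(0, 1), (0, 2), (0, 3), (0, 4), (1, 4), (1, 5), (2, 5), (3, 5)]

/-- The permutation of the set of pairs induced by the braiding. -/
def hurwitz (p : Fin 6 × Fin 6) : Fin 6 × Fin 6 := (phiB p.1 p.2, p.1)

/-- A representative of each orbit of `hurwitz`. -/
def orbitRep : Fin 6 ⊕ Fin 3 ⊕ Fin 8 → Fin 6 × Fin 6 :=
  Sum.elim orbitOne (Sum.elim orbitTwo orbitThree)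

lemma exists_orbitRep : ∀ p : Fin 6 × Fin 6, ∃ s, p = orbitRep s ∨ p = hurwitz (orbitRep s) ∨
    p = hurwitz (hurwitz (orbitRep s)) := by decide +kernel

lemma hurwitz_injective : Function.Injective hurwitz := by
  rintro ⟨a, b⟩ ⟨a', b'⟩ h
  simp only [hurwitz, Prod.mk.injEq] at h
  obtain ⟨h1, rfl⟩ := h
  rw [(phiB a).apply_eq_iff_eq] at h1
  rw [h1]

lemma hurwitz_cube : ∀ p : Fin 6 × Fin 6, phiB p.1 p.2 ≠ p.2 →
    hurwitz (hurwitz (hurwitz p)) = p := by decide +kernel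

variable {a : Fin 6 → Fin 6 → k} {f : Fin 6 × Fin 6 → k}

lemma eq_zero_of_orbitRep (hf : ∀ p, f (hurwitz p) = -(a p.1 p.2 * f p))
    (h : ∀ s, f (orbitRep s) = 0) : f = 0 := by
  funext p
  obtain ⟨s, rfl | rfl | rfl⟩ := exists_orbitRep p
  · exact h s
  · rw [hf, h]; simp
  · rw [hf, hf, h]; simp

variable (v : Module.Basis (Fin 6) k V) {c}
variable (hc : ∀ i j, c (v i ⊗ₜ v j) = a i j • (v (phiB i j) ⊗ₜ v i))
include hc

lemma repr_hurwitz (z : V ⊗[k] V) (p : Fin 6 × Fin 6) :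
    (v.tensorProduct v).repr (c z) (hurwitz p) = a p.1 p.2 * (v.tensorProduct v).repr z p := by
  have : (v.tensorProduct v).coord (hurwitz p) ∘ₗ c =
      a p.1 p.2 • (v.tensorProduct v).coord p := by
    refine (v.tensorProduct v).ext fun q => ?_
    rw [LinearMap.comp_apply, Module.Basis.tensorProduct_apply', hc, map_smul,
      ← Module.Basis.tensorProduct_apply, LinearMap.smul_apply,
      ← Module.Basis.tensorProduct_apply, Module.Basis.coord_apply, Module.Basis.coord_apply,
      Module.Basis.repr_self, Module.Basis.repr_self]
    change _ • Finsupp.single (hurwitz q) _ _ = _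
    by_cases h : q = p
    · subst h; simp
    · rw [Finsupp.single_eq_of_ne (fun e => h (hurwitz_injective e.symm)),
        Finsupp.single_eq_of_ne (fun e => h e.symm), smul_zero, smul_zero]
  exact LinearMap.congr_fun this z

/-- If `c z = -z`, the coordinates of `z` along an orbit of `hurwitz` determine each other.
Positions at which vanishing forces `z = 0` therefore bound the dimension. -/
lemma finrank_ker_le {I : Type*} [Fintype I] (s : I → Fin 6 × Fin 6)
    (hs : ∀ f : Fin 6 × Fin 6 → k, (∀ p, f (hurwitz p) = -(a p.1 p.2 * f p)) →
      (∀ i, f (s i) = 0) → f = 0) :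
    Module.finrank k (LinearMap.ker (LinearMap.id + c)) ≤ Fintype.card I := by
  let F : LinearMap.ker (LinearMap.id + c) →ₗ[k] (I → k) :=
    (LinearMap.pi fun i => (v.tensorProduct v).coord (s i)) ∘ₗ Submodule.subtype _
  have hF : Function.Injective F := by
    rw [← LinearMap.ker_eq_bot, LinearMap.ker_eq_bot']
    rintro ⟨z, hz⟩ h
    have hz' : c z = -z := by
      rw [LinearMap.mem_ker, LinearMap.add_apply] at hz
      exact eq_neg_of_add_eq_zero_right hz
    have h0 := hs (fun p => (v.tensorProduct v).repr z p) (fun p => by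
      rw [← repr_hurwitz v hc, hz']; simp) (fun i => congrFun h i)
    refine Subtype.ext ?_
    apply (v.tensorProduct v).repr.injective
    ext p
    simpa using congrFun h0 p
  simpa using LinearMap.finrank_le_finrank_of_injective hF

/-- If `𝔅₂(V)` is small, then the braiding has the eigenvalue `-1` on each orbit. -/
theorem scalars_of_rank_homogeneous_two_le {q r P : k} (hq : ∀ i, a i i = q)
    (hr : ∀ i j, i ≠ j → phiB i j = j → a i j = r)
    (hP : ∀ i j, phiB i j ≠ j → a i j * a (phiB i j) i * a j (phiB i j) = P)
    (h : Module.rank k (homogeneous c 2) ≤ (21 : ℕ)) : q = -1 ∧ r * r = 1 ∧ P = -1 := by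
  have hfin : Module.Finite k V := Module.Finite.of_basis v
  have hV : Module.finrank k V = 6 := by rw [Module.finrank_eq_card_basis v]; simp
  have h1 := finrank_range_le c h
  have h2 := LinearMap.finrank_range_add_finrank_ker (LinearMap.id + c)
  rw [Module.finrank_tensorProduct, hV] at h2
  -- The kernel has dimension at least `36 - 21 = 15`, while there are 17 orbits; losing those of
  -- length one, two or three would leave at most 11, 14 or 9.
  have h3 : ¬ Module.finrank k (LinearMap.ker (LinearMap.id + c)) ≤ 14 := by omega
  refine ⟨?_, ?_, ?_⟩ <;> by_contra hne <;> apply h3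
  · refine (finrank_ker_le v hc (Sum.elim orbitTwo orbitThree) ?_).trans (by simp)
    intro f hf h0
    refine eq_zero_of_orbitRep hf ?_
    rintro (i | i)
    · have h4 := hf (i, i)
      have h5 : hurwitz (i, i) = (i, i) := (by decide : ∀ i, hurwitz (i, i) = (i, i)) i
      have h6 : (q + 1) * f (i, i) = 0 := by
        rw [h5, hq] at h4; linear_combination h4
      exact (mul_eq_zero.1 h6).resolve_left fun e => hne (eq_neg_of_add_eq_zero_left e)
    · exact h0 i
  · refine (finrank_ker_le v hc (Sum.elim orbitOne orbitThree) ?_).trans (by simp)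
    intro f hf h0
    refine eq_zero_of_orbitRep hf ?_
    rintro (i | i | i)
    · exact h0 (Sum.inl i)
    · have h4 := hf (orbitTwo i)
      have h5 := hf (hurwitz (orbitTwo i))
      have h6 : hurwitz (hurwitz (orbitTwo i)) = orbitTwo i :=
        (by decide : ∀ i, hurwitz (hurwitz (orbitTwo i)) = orbitTwo i) i
      have h7 : (orbitTwo i).1 ≠ (orbitTwo i).2 ∧
          phiB (orbitTwo i).1 (orbitTwo i).2 = (orbitTwo i).2 := by
        clear h4 h5 h6; revert i; decide
      have h8 : (hurwitz (orbitTwo i)).1 ≠ (hurwitz (orbitTwo i)).2 ∧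
          phiB (hurwitz (orbitTwo i)).1 (hurwitz (orbitTwo i)).2 = (hurwitz (orbitTwo i)).2 := by
        clear h4 h5 h6 h7; revert i; decide
      rw [hr _ _ h7.1 h7.2] at h4
      rw [h6, hr _ _ h8.1 h8.2, h4] at h5
      have h9 : (r * r - 1) * f (orbitTwo i) = 0 := by linear_combination -h5
      exact (mul_eq_zero.1 h9).resolve_left fun e => hne (sub_eq_zero.1 e)
    · exact h0 (Sum.inr i)
  · refine (finrank_ker_le v hc (Sum.elim orbitOne orbitTwo) ?_).trans (by simp)
    intro f hf h0
    refine eq_zero_of_orbitRep hf ?_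
    rintro (i | i | i)
    · exact h0 (Sum.inl i)
    · exact h0 (Sum.inr i)
    · have h4 : phiB (orbitThree i).1 (orbitThree i).2 ≠ (orbitThree i).2 := by revert i; decide
      change f (orbitThree i) = 0
      generalize orbitThree i = p at h4
      have h6 := hurwitz_cube p h4
      have h7 : hurwitz (hurwitz p) = (p.2, phiB p.1 p.2) := by
        have := congrArg Prod.snd h6
        have h8 := congrArg Prod.fst h6
        simp only [hurwitz] at this h8 ⊢
        rw [this]
      -- Going once around an orbit of length three multiplies `f p` by `-P`.
      have e3 := hf (hurwitz (hurwitz p))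
      have e2 := hf (hurwitz p)
      have e1 := hf p
      rw [h6, e2, e1, h7] at e3
      have e := hP p.1 p.2 h4
      change _ = -(a p.2 (phiB p.1 p.2) * -(a (phiB p.1 p.2) p.1 * _)) at e3
      have h9 : (P + 1) * f p = 0 := by rw [← e]; linear_combination e3
      exact (mul_eq_zero.1 h9).resolve_left fun e => hne (eq_neg_of_add_eq_zero_left e)

end Kernel

end Nichols

/-! ### The enveloping group and the centralizer of the first generator -/

theorem GroupB.induction {P : GroupB → Prop} (one : P 1) (gen : ∀ i, P (genB i))
    (mul : ∀ g h, P g → P h → P (g * h)) (inv : ∀ g, P g → P g⁻¹) (g : GroupB) : P g := by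
  induction g using Quotient.inductionOn with
  | h g =>
    induction g with
    | unit => exact one
    | incl x => exact gen x
    | mul a b ha hb => exact mul _ _ ha hb
    | inv a ha => exact inv _ ha

/-- The action of the enveloping group on the rack. -/
def rackAction : GroupB →* Equiv.Perm (Fin 6) := Rack.envelAction (R := RackB)

lemma rackAction_genB (i : Fin 6) : rackAction (genB i) = phiB i := by
  ext j
  exact congrArg Fin.val (Rack.envelAction_prop (R := RackB) i j)

lemma conj_genB (g : GroupB) (i : Fin 6) : g * genB i * g⁻¹ = genB (rackAction g i) := by
  revert i
  induction g using GroupB.induction with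
  | one => simp
  | gen j => intro i; rw [genB_mul, rackAction_genB, mul_inv_cancel_right]
  | mul g h hg hh => intro i; rw [map_mul, Equiv.Perm.mul_apply, ← hg, ← hh]; group
  | inv g hg =>
    intro i
    have := hg ((rackAction g).symm i)
    rw [Equiv.apply_symm_apply] at this
    rw [← this, map_inv]
    simp only [mul_assoc, inv_mul_cancel_left, inv_inv, inv_mul_cancel, mul_one]
    rfl

lemma phiB_injective : Function.Injective phiB := by
  have : ∀ i j, phiB i = phiB j → i = j := by decide +kernel
  exact fun i j => this i j

lemma genB_injective : Function.Injective genB := by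
  intro i j h
  exact phiB_injective (by rw [← rackAction_genB, h, rackAction_genB])

/-- The element `j` of the rack such that `i` and `j` commute and `i ≠ j`. -/
def opposite : Fin 6 → Fin 6 := ![5, 3, 4, 1, 2, 0]

lemma genB_mul' {i j l : Fin 6} (h : phiB i j = l) : genB i * genB j = genB l * genB i := by
  rw [genB_mul, h]

/-- One such equality follows from the relations after multiplying by a further generator on the
right; conjugation by `genB 0`, which commutes with `genB 0 * genB 5`, and commutation within pairs
give the others. -/
lemma genB_mul_opposite (i : Fin 6) : genB i * genB (opposite i) = genB 0 * genB 5 := by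
  have h24 : genB 2 * genB 4 = genB 0 * genB 5 := by
    rw [← mul_left_inj (genB 1), mul_assoc, mul_assoc,
      genB_mul' (i := 5) (j := 1) (l := 4) (by decide),
      genB_mul' (i := 4) (j := 5) (l := 1) (by decide),
      ← mul_assoc, ← mul_assoc, genB_mul' (i := 0) (j := 1) (l := 2) (by decide),
      mul_assoc, mul_assoc, genB_mul' (i := 0) (j := 4) (l := 1) (by decide),
      genB_mul' (i := 1) (j := 0) (l := 4) (by decide)]
  have h31 : genB 3 * genB 1 = genB 0 * genB 5 := by
    have h1 : genB 3 * genB 1 = genB 0 * (genB 2 * genB 4) * (genB 0)⁻¹ := by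
      rw [eq_mul_inv_iff_mul_eq, ← mul_assoc, genB_mul' (i := 0) (j := 2) (l := 3) (by decide),
        mul_assoc, mul_assoc, genB_mul' (i := 0) (j := 4) (l := 1) (by decide)]
    rw [h1, h24, mul_inv_eq_iff_eq_mul, mul_assoc, genB_mul' (i := 5) (j := 0) (l := 0) (by decide)]
  fin_cases i
  · rfl
  · exact (genB_mul' (i := 1) (j := 3) (l := 3) (by decide)).trans h31
  · exact h24
  · exact h31
  · exact (genB_mul' (i := 4) (j := 2) (l := 2) (by decide)).trans h24
  · exact genB_mul' (i := 5) (j := 0) (l := 0) (by decide)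

lemma mem_center_of_commute {y : GroupB} (h : ∀ i, genB i * y = y * genB i) :
    y ∈ Subgroup.center GroupB := by
  rw [Subgroup.mem_center_iff]
  intro g
  induction g using GroupB.induction with
  | one => simp
  | gen i => exact h i
  | mul g g' hg hg' => rw [mul_assoc, hg', ← mul_assoc, hg, mul_assoc]
  | inv g hg => rw [inv_mul_eq_iff_eq_mul, ← mul_assoc, hg, mul_inv_cancel_right]

lemma genB_mul_genB_mem_center : genB 0 * genB 5 ∈ Subgroup.center GroupB := by
  refine mem_center_of_commute fun i => ?_
  have h : phiB i 5 = opposite (phiB i 0) := by revert i; decide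
  rw [← mul_assoc, genB_mul, mul_assoc, genB_mul, ← mul_assoc, h, genB_mul_opposite]

lemma mem_center_of_rackAction_eq_one {g : GroupB} (h : rackAction g = 1) :
    g ∈ Subgroup.center GroupB := by
  refine mem_center_of_commute fun i => ?_
  have := conj_genB g i
  rw [h, Equiv.Perm.one_apply, mul_inv_eq_iff_eq_mul] at this
  exact this.symm

/-- A centralizing element fixes the indices 0 and 5 and commutes with the 4-cycle `φ_0` on the
other four, so it acts as a power of `φ_0`. Dividing by that power of `genB 0` leaves an element
acting trivially, which is central. -/
lemma exists_center_mul_pow {g : GroupB} (hg : g ∈ Subgroup.centralizer {genB 0}) :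
    ∃ z ∈ Subgroup.center GroupB, ∃ m : ℕ, g = z * genB 0 ^ m := by
  have hg' : genB 0 * g = g * genB 0 := (Subgroup.mem_centralizer_singleton_iff.1 hg).symm
  have hy := Subgroup.mem_center_iff.1 genB_mul_genB_mem_center
  set p := rackAction g with hp
  have p0 : p 0 = 0 := genB_injective (by
    rw [← conj_genB, ← hg', mul_inv_cancel_right])
  have p5 : p 5 = 5 := genB_injective (by
    rw [← conj_genB, mul_inv_eq_iff_eq_mul, ← mul_right_inj (genB 0), ← mul_assoc, hg', mul_assoc,
      hy, mul_assoc])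
  have hcomm : ∀ i, p (phiB 0 i) = phiB 0 (p i) := by
    intro i
    have := congrArg rackAction hg'
    rw [map_mul, map_mul, rackAction_genB] at this
    exact (congrArg (fun s : Equiv.Perm (Fin 6) => s i) this).symm
  obtain ⟨m, hm⟩ : ∃ m : ℕ, p 1 = (phiB 0 ^ m) 1 := by
    have h0 : p 1 ≠ 0 := fun h => by rw [← p0] at h; exact absurd (p.injective h) (by decide)
    have h5 : p 1 ≠ 5 := fun h => by rw [← p5] at h; exact absurd (p.injective h) (by decide)
    have : ∀ i : Fin 6, i ≠ 0 → i ≠ 5 → ∃ m : Fin 4, i = (phiB 0 ^ (m : ℕ)) 1 := by decide +kernel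
    obtain ⟨m, hm⟩ := this _ h0 h5
    exact ⟨m, hm⟩
  refine ⟨g * (genB 0 ^ m)⁻¹, mem_center_of_rackAction_eq_one ?_, m, by group⟩
  rw [map_mul, map_inv, map_pow, rackAction_genB, mul_inv_eq_one, ← hp]
  have hpow : ∀ i, phiB 0 ((phiB 0 ^ m) i) = (phiB 0 ^ m) (phiB 0 i) := fun i => by
    rw [← Equiv.Perm.mul_apply, ← Equiv.Perm.mul_apply, (Commute.self_pow _ _).eq]
  have step : ∀ i, p i = (phiB 0 ^ m) i → p (phiB 0 i) = (phiB 0 ^ m) (phiB 0 i) := by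
    intro i hi; rw [hcomm, hi, hpow]
  have e2 := step 1 hm
  have e3 := step _ e2
  have e4 := step _ e3
  ext i
  congr 1
  fin_cases i
  · exact p0.trans (Equiv.Perm.pow_apply_eq_self_of_apply_eq_self (by decide) m).symm
  · exact hm
  · exact e2
  · exact e3
  · exact e4
  · exact p5.trans (Equiv.Perm.pow_apply_eq_self_of_apply_eq_self (by decide) m).symm

lemma centralizer_mul_comm (a b : Subgroup.centralizer {genB 0}) : a * b = b * a := by
  obtain ⟨z, hz, m, h1⟩ := exists_center_mul_pow a.2
  have hb := Subgroup.mem_centralizer_singleton_iff.1 b.2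
  have hz' := Subgroup.mem_center_iff.1 hz
  apply Subtype.ext
  have hc : Commute (b : GroupB) (genB 0) := hb
  rw [Subgroup.coe_mul, Subgroup.coe_mul, h1, ← mul_assoc, hz', mul_assoc, mul_assoc,
    (hc.pow_right m).eq]

/-! ### Absolutely simple representations of commutative groups -/

namespace Representation

variable {k : Type u} {G : Type} {W : Type v} [Field k] [AddCommGroup W] [Module k W]

lemma IsIrreducible.eq_bot_or_eq_top [Group G] {ρ : Representation k G W} (hρ : ρ.IsIrreducible)
    (N : Submodule k W) (hN : ∀ g, ∀ w ∈ N, ρ g w ∈ N) : N = ⊥ ∨ N = ⊤ := by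
  have := hρ
  rcases IsSimpleOrder.eq_bot_or_eq_top (⟨N, hN⟩ : Subrepresentation ρ) with h | h
  · left; exact congrArg Subrepresentation.toSubmodule h
  · right; exact congrArg Subrepresentation.toSubmodule h

lemma IsIrreducible.nontrivial_module [Group G] {ρ : Representation k G W}
    (hρ : ρ.IsIrreducible) : Nontrivial W := by
  by_contra h
  rw [not_nontrivial_iff_subsingleton] at h
  have := hρ
  have h2 : (⊥ : Subrepresentation ρ) ≠ ⊤ := bot_ne_top
  exact h2 (Subrepresentation.toSubmodule_injective (Subsingleton.elim _ _))

variable [CommGroup G] {ρ : Representation k G W} (hρ : ρ.IsAbsolutelySimple)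
include hρ

lemma IsAbsolutelySimple.eq_bot_or_eq_top (N : Submodule k W) (hN : ∀ g, ∀ w ∈ N, ρ g w ∈ N) :
    N = ⊥ ∨ N = ⊤ := by
  have h : ∀ g z, _root_.TensorProduct.lid k W (ρ.extendScalars k g z) = ρ g (_root_.TensorProduct.lid k W z) := by
    intro g z
    induction z using TensorProduct.induction_on with
    | zero => simp
    | tmul a b => simp [extendScalars]
    | add a b ha hb => simp only [map_add, ha, hb]
  rcases (hρ k).eq_bot_or_eq_top (N.comap (_root_.TensorProduct.lid k W).toLinearMap) (fun g z hz => by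
    change _root_.TensorProduct.lid k W _ ∈ N
    rw [h]; exact hN g _ hz) with h | h
  · left
    rw [eq_bot_iff]
    intro w hw
    have : (1 : k) ⊗ₜ[k] w ∈ N.comap (_root_.TensorProduct.lid k W).toLinearMap := by simpa using hw
    rw [h, Submodule.mem_bot] at this
    simpa using congrArg (_root_.TensorProduct.lid k W) this
  · right
    rw [eq_top_iff]
    intro w _
    have : (1 : k) ⊗ₜ[k] w ∈ N.comap (_root_.TensorProduct.lid k W).toLinearMap := by rw [h]; trivial
    simpa using this

lemma IsAbsolutelySimple.nontrivial : Nontrivial W := by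
  have := (hρ k).nontrivial_module
  exact (_root_.TensorProduct.lid k W).symm.toEquiv.nontrivial

omit hρ in
lemma asAlgebraHom_comm (a b : MonoidAlgebra k G) (w : W) :
    ρ.asAlgebraHom a (ρ.asAlgebraHom b w) = ρ.asAlgebraHom b (ρ.asAlgebraHom a w) := by
  rw [← Module.End.mul_apply, ← Module.End.mul_apply, ← map_mul, ← map_mul, mul_comm]

/-- Schur's lemma: a non-zero operator from the commutative image has zero kernel, and the orbit of
a non-zero vector is everything, which yields an inverse modulo the annihilator. -/
lemma IsAbsolutelySimple.isMaximal_ker : (RingHom.ker ρ.asAlgebraHom).IsMaximal := by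
  have := hρ.nontrivial
  have hstab : ∀ a : MonoidAlgebra k G, ρ.asAlgebraHom a ≠ 0 → LinearMap.ker (ρ.asAlgebraHom a) = ⊥ := by
    intro a ha
    refine (hρ.eq_bot_or_eq_top _ ?_).resolve_right fun h => ha (LinearMap.ker_eq_top.1 h)
    intro g w hw
    rw [LinearMap.mem_ker] at hw ⊢
    rw [← asAlgebraHom_single_one, asAlgebraHom_comm, hw, map_zero]
  obtain ⟨w, hw⟩ := exists_ne (0 : W)
  rw [Ideal.isMaximal_iff]
  refine ⟨by simp [RingHom.mem_ker], fun J a hJ ha haJ => ?_⟩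
  rw [RingHom.mem_ker] at ha
  let F : MonoidAlgebra k G →ₗ[k] W := LinearMap.applyₗ (ρ.asAlgebraHom a w) ∘ₗ
    ρ.asAlgebraHom.toLinearMap
  have hF : ∀ b, F b = ρ.asAlgebraHom b (ρ.asAlgebraHom a w) := fun b => rfl
  have hr : LinearMap.range F = ⊤ := by
    refine (hρ.eq_bot_or_eq_top _ ?_).resolve_left fun h => ?_
    · rintro g _ ⟨b, rfl⟩
      refine ⟨MonoidAlgebra.single g 1 * b, ?_⟩
      rw [hF, hF, map_mul, Module.End.mul_apply, asAlgebraHom_single_one]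
    · have h1 : F 1 = 0 := by
        have : F 1 ∈ LinearMap.range F := ⟨1, rfl⟩
        rwa [h] at this
      rw [hF, map_one, Module.End.one_apply] at h1
      have h2 : w ∈ LinearMap.ker (ρ.asAlgebraHom a) := h1
      rw [hstab a ha] at h2
      exact hw h2
  obtain ⟨b, hb⟩ : w ∈ LinearMap.range F := by rw [hr]; trivial
  have h1 : ρ.asAlgebraHom (b * a - 1) = 0 := by
    by_contra h
    have h2 : w ∈ LinearMap.ker (ρ.asAlgebraHom (b * a - 1)) := by
      rw [LinearMap.mem_ker, map_sub, map_mul, map_one, LinearMap.sub_apply,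
        Module.End.mul_apply, ← hF, hb, Module.End.one_apply, sub_self]
    rw [hstab _ h] at h2
    exact hw h2
  have h2 := J.sub_mem (J.mul_mem_left b haJ) (hJ (RingHom.mem_ker.2 h1))
  rwa [sub_sub_cancel] at h2

/-- An absolutely simple representation of a commutative group has dimension one. -/
theorem IsAbsolutelySimple.finrank_eq_one : Module.finrank k W = 1 := by
  have := hρ.nontrivial
  have hmax := hρ.isMaximal_ker
  let m : Ideal (MonoidAlgebra k G) := RingHom.ker ρ.asAlgebraHom
  let _ : Field (MonoidAlgebra k G ⧸ m) := Ideal.Quotient.field m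
  -- The representation is extended to the field generated by its own operators. As `G` lies in
  -- `Type`, this field stays in the universe over which absolute simplicity quantifies.
  let K : Type u := MonoidAlgebra k G ⧸ m
  let θ : K →ₐ[k] Module.End k W := Ideal.Quotient.liftₐ m ρ.asAlgebraHom fun a ha => ha
  have hθ : ∀ a, θ (Ideal.Quotient.mk m a) = ρ.asAlgebraHom a := fun a => rfl
  let Ψ : K ⊗[k] W →ₗ[k] W := TensorProduct.lift θ.toLinearMap
  have hΨ : ∀ a w, Ψ (a ⊗ₜ w) = θ a w := fun a w => rfl
  have hΨs : ∀ (a : K) z, Ψ (a • z) = θ a (Ψ z) := by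
    intro a z
    induction z using TensorProduct.induction_on with
    | zero => simp
    | tmul b w => rw [TensorProduct.smul_tmul', hΨ, hΨ, smul_eq_mul, map_mul, Module.End.mul_apply]
    | add x y hx hy => simp only [smul_add, map_add, hx, hy]
  have hΨg : ∀ g z, Ψ (ρ.extendScalars K g z) = ρ g (Ψ z) := by
    intro g z
    induction z using TensorProduct.induction_on with
    | zero => simp
    | tmul b w =>
      obtain ⟨b, rfl⟩ := Ideal.Quotient.mk_surjective b
      change Ψ (_ ⊗ₜ ρ g w) = _
      change ρ.asAlgebraHom b (ρ g w) = ρ g (ρ.asAlgebraHom b w)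
      rw [← asAlgebraHom_single_one, asAlgebraHom_comm, asAlgebraHom_single_one]
    | add x y hx hy => simp only [map_add, hx, hy]
  let N : Submodule K (K ⊗[k] W) :=
    { carrier := {z | Ψ z = 0}
      zero_mem' := map_zero Ψ
      add_mem' := fun {a b} ha hb => by
        change Ψ (a + b) = 0
        rw [map_add, show Ψ a = 0 from ha, show Ψ b = 0 from hb, add_zero]
      smul_mem' := fun a z hz => by
        change Ψ (a • z) = 0
        rw [hΨs, show Ψ z = 0 from hz, map_zero] }
  obtain ⟨w, hw⟩ := exists_ne (0 : W)
  -- The evaluation `K ⊗ W → W` is equivariant and `K`-linear, and sends `1 ⊗ w` to `w`; its kernel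
  -- is thus a proper subrepresentation over `K`, hence zero.
  have hN : N = ⊥ := by
    refine ((hρ K).eq_bot_or_eq_top N fun g z hz => ?_).resolve_right fun h => ?_
    · change Ψ _ = 0
      rw [hΨg, show Ψ z = 0 from hz, map_zero]
    · have : (1 : K) ⊗ₜ[k] w ∈ N := by rw [h]; trivial
      have h2 : Ψ ((1 : K) ⊗ₜ w) = 0 := this
      rw [hΨ, map_one] at h2
      exact hw h2
  obtain ⟨f, hf⟩ := Module.Projective.exists_dual_eq_one k hw
  have hscal : ∀ g, ρ g w = f (ρ g w) • w := by
    intro g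
    let a : K := Ideal.Quotient.mk m (MonoidAlgebra.single g 1)
    have ha : θ a w = ρ g w := asAlgebraHom_single_one ρ g ▸ rfl
    -- Evaluation does not see the difference, so the two tensors agree. Applying the functional `f`
    -- to the second factor shows that `a` is a scalar from `k`.
    have h1 : a ⊗ₜ[k] w - (1 : K) ⊗ₜ[k] ρ g w ∈ N := by
      change Ψ _ = 0
      rw [map_sub, hΨ, hΨ, map_one, ha, Module.End.one_apply, sub_self]
    rw [hN, Submodule.mem_bot, sub_eq_zero] at h1
    have h2 := congrArg (fun z => _root_.TensorProduct.rid k K (f.lTensor K z)) h1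
    simp only [LinearMap.lTensor_tmul, _root_.TensorProduct.rid_tmul, hf, one_smul] at h2
    conv_lhs => rw [← ha, h2, map_smul, map_one, LinearMap.smul_apply, Module.End.one_apply]
  have hspan : Submodule.span k {w} = ⊤ := by
    refine (hρ.eq_bot_or_eq_top _ fun g x hx => ?_).resolve_left fun h => hw ?_
    · obtain ⟨r, rfl⟩ := Submodule.mem_span_singleton.1 hx
      rw [map_smul, hscal, smul_smul]
      exact Submodule.mem_span_singleton.2 ⟨_, rfl⟩
    · exact Submodule.span_singleton_eq_bot.1 h
  exact _root_.finrank_eq_one w hw fun x => Submodule.mem_span_singleton.1 (by rw [hspan]; trivial)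

end Representation

/-! ### Homogeneous components and induced Yetter-Drinfeld modules -/

namespace YetterDrinfeld

section General

variable {k G V : Type*} [Field k] [Group G] [AddCommGroup V] [Module k V]
  (M : YetterDrinfeld k G V)

lemma smul_mem_component {g : G} {x : V} (hx : x ∈ M.component g) (r : k) :
    r • x ∈ M.component g := by
  have hx' : M.coact x = MonoidAlgebra.single g (1 : k) ⊗ₜ[k] x := hx
  change M.coact (r • x) = _
  rw [map_smul, hx', TensorProduct.tmul_smul]

lemma act_mem_component {g : G} {x : V} (hx : x ∈ M.component g) (h : G) :
    M.act h x ∈ M.component (h * g * h⁻¹) := by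
  have hx' : M.coact x = MonoidAlgebra.single g (1 : k) ⊗ₜ[k] x := hx
  have := LinearMap.congr_fun (M.compat h) x
  rw [LinearMap.comp_apply, LinearMap.comp_apply, hx', TensorProduct.map_tmul] at this
  change M.coact (M.act h x) = _
  rw [this]
  simp [MonoidAlgebra.single_mul_single, mul_assoc]

/-- The projection onto the component of degree `g`. -/
def componentProj (g : G) : V →ₗ[k] V :=
  (TensorProduct.lid k V).toLinearMap ∘ₗ
    (Finsupp.lapply g ∘ₗ (MonoidAlgebra.coeffLinearEquiv k).toLinearMap).rTensor V ∘ₗ M.coact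

open Classical in
lemma componentProj_apply {g h : G} {x : V} (hx : x ∈ M.component h) :
    M.componentProj g x = if h = g then x else 0 := by
  have hx' : M.coact x = MonoidAlgebra.single h (1 : k) ⊗ₜ[k] x := hx
  by_cases e : h = g <;> simp [componentProj, hx', e]

/-- Projecting a linear relation to one component isolates one coefficient, since the degrees are
distinct. -/
lemma linearIndependent_of_component {I : Type*} [Fintype I] {g : I → G}
    (hg : Function.Injective g) {w : I → V} (hw : ∀ i, w i ≠ 0 ∧ w i ∈ M.component (g i)) :
    LinearIndependent k w := by
  classical
  rw [Fintype.linearIndependent_iff]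
  intro f hf j
  have h := congrArg (M.componentProj (g j)) hf
  rw [map_sum, map_zero, Finset.sum_eq_single j] at h
  · rw [map_smul, M.componentProj_apply (hw j).2, if_pos rfl] at h
    exact (smul_eq_zero.1 h).resolve_right (hw j).1
  · intro i _ hij
    rw [map_smul, M.componentProj_apply (hw i).2, if_neg (fun e => hij (hg e)), smul_zero]
  · simp

lemma eq_smul_of_mem_component {I : Type*} [Fintype I] {g : I → G}
    (hg : Function.Injective g) (b : Module.Basis I k V) (hb : ∀ i, b i ∈ M.component (g i))
    {i : I} {x : V} (hx : x ∈ M.component (g i)) : x = b.repr x i • b i := by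
  classical
  have h := congrArg (M.componentProj (g i)) (b.sum_repr x)
  rw [map_sum, Finset.sum_eq_single i, M.componentProj_apply hx, map_smul,
    M.componentProj_apply (hb i), if_pos rfl, if_pos rfl] at h
  · exact h.symm
  · intro j _ hij
    rw [map_smul, M.componentProj_apply (hb j), if_neg (fun e => hij (hg e)), smul_zero]
  · simp

end General

section Induced

variable {k G W : Type*} [Field k] [Group G] [AddCommGroup W] [Module k W] (g : G)
  (ρ : Representation k (Subgroup.centralizer {g}) W)

lemma indMk_mul (c : Subgroup.centralizer {g}) (h : G) (w : W) :
    Representation.IndV.mk (Subgroup.centralizer {g}).subtype ρ (c * h) (ρ c w) =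
      Representation.IndV.mk (Subgroup.centralizer {g}).subtype ρ h w := by
  have := Representation.Coinvariants.mk_self_apply
    (Representation.tprod ((Representation.leftRegular k G).comp
      (Subgroup.centralizer {g}).subtype) ρ) c (MonoidAlgebra.single h 1 ⊗ₜ[k] w)
  simpa using this

/-- The element `1 ⊗ w` of the induced Yetter-Drinfeld module. -/
def indOne : W →ₗ[k] Representation.IndV (Subgroup.centralizer {g}).subtype ρ :=
  Representation.IndV.mk (Subgroup.centralizer {g}).subtype ρ 1

lemma act_indOne (h : G) (w : W) : (induced g ρ).act h (indOne g ρ w) =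
    Representation.IndV.mk (Subgroup.centralizer {g}).subtype ρ h⁻¹ w := by
  change Representation.ind _ ρ h (Representation.IndV.mk _ ρ 1 w) = _
  rw [Representation.ind_mk, one_mul]

lemma act_coe_indOne (c : Subgroup.centralizer {g}) (w : W) :
    (induced g ρ).act (c : G) (indOne g ρ w) = indOne g ρ (ρ c w) := by
  rw [act_indOne, ← indMk_mul g ρ c, mul_inv_cancel]
  rfl

lemma indOne_mem_component (w : W) : indOne g ρ w ∈ (induced g ρ).component g := by
  have := inducedCoact_mk g ρ 1 w
  rw [inv_one, one_mul, mul_one] at this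
  exact this

open Classical in
/-- The retraction of `indOne`. -/
def indRetraction : Representation.IndV (Subgroup.centralizer {g}).subtype ρ →ₗ[k] W :=
  Representation.Coinvariants.lift _
    (TensorProduct.lift
      (Finsupp.lift _ k G (fun h => if hh : h ∈ Subgroup.centralizer {g} then ρ ⟨h, hh⟩⁻¹ else 0) ∘ₗ
        (MonoidAlgebra.coeffLinearEquiv k).toLinearMap))
    (fun c => by
      ext h w
      have hc : (c * h ∈ Subgroup.centralizer {g}) ↔ h ∈ Subgroup.centralizer {g} :=
        Subgroup.mul_mem_cancel_left _ c.2
      by_cases hh : h ∈ Subgroup.centralizer {g}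
      · have h2 : (⟨c * h, hc.2 hh⟩ : Subgroup.centralizer {g})⁻¹ * c = ⟨h, hh⟩⁻¹ := by
          ext; simp
        have h3 := congrArg (fun x => ρ x w) h2
        simp only [map_mul, Module.End.mul_apply] at h3
        simpa [hc, hh] using h3
      · simp [hc, hh])

lemma indRetraction_indOne (w : W) : indRetraction g ρ (indOne g ρ w) = w := by
  have h1 : (1 : G) ∈ Subgroup.centralizer {g} := one_mem _
  have h2 : (⟨1, h1⟩ : Subgroup.centralizer {g}) = 1 := rfl
  simp [indRetraction, indOne, h1, h2]

lemma indOne_injective : Function.Injective (indOne g ρ) :=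
  Function.LeftInverse.injective (g := indRetraction g ρ) (indRetraction_indOne g ρ)

end Induced

end YetterDrinfeld

/-! ### Structure constants of the induced module -/

/-- Elements which conjugate `x₁` to the generators. -/
def transversal : Fin 6 → GroupB := ![1, genB 2, genB 3, genB 4, genB 1, genB 1 * genB 1]

lemma rackAction_transversal (i : Fin 6) :
    rackAction (transversal i) 0 = i ∧ rackAction (transversal i) 5 = opposite i := by
  fin_cases i <;> simp [transversal, rackAction_genB] <;> decide

lemma transversal_mul_genB_zero (i : Fin 6) : genB i * transversal i = transversal i * genB 0 := by
  have := conj_genB (transversal i) 0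
  rw [(rackAction_transversal i).1, mul_inv_eq_iff_eq_mul] at this
  exact this.symm

lemma transversal_mul_genB_five (i : Fin 6) :
    genB (opposite i) * transversal i = transversal i * genB 5 := by
  have := conj_genB (transversal i) 5
  rw [(rackAction_transversal i).2, mul_inv_eq_iff_eq_mul] at this
  exact this.symm

lemma inv_transversal_mul_mem (g : GroupB) :
    (transversal (rackAction g 0))⁻¹ * g ∈ Subgroup.centralizer {genB 0} := by
  have h := conj_genB g 0
  have h2 := conj_genB (transversal (rackAction g 0)) 0
  rw [(rackAction_transversal _).1, ← h, mul_inv_eq_iff_eq_mul] at h2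
  rw [Subgroup.mem_centralizer_singleton_iff, mul_assoc, inv_mul_eq_iff_eq_mul, ← mul_assoc,
    ← mul_assoc, h2]
  group

namespace YetterDrinfeld

variable {k W : Type*} [Field k] [AddCommGroup W] [Module k W]
  (ρ : Representation k (Subgroup.centralizer {genB 0}) W)

/-- Representatives of the cosets applied to `1 ⊗ w`. -/
def inducedVec (w : W) (i : Fin 6) :
    Representation.IndV (Subgroup.centralizer {genB 0}).subtype ρ :=
  (induced (genB 0) ρ).act (transversal i) (indOne (genB 0) ρ w)

lemma inducedVec_mem (w : W) (i : Fin 6) :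
    inducedVec ρ w i ∈ (induced (genB 0) ρ).component (genB i) := by
  have := act_mem_component _ (indOne_mem_component (genB 0) ρ w) (transversal i)
  rwa [conj_genB, (rackAction_transversal i).1] at this

lemma act_injective {G V : Type*} [Group G] [AddCommGroup V] [Module k V]
    (τ : Representation k G V) (g : G) : Function.Injective (τ g) := by
  refine Function.LeftInverse.injective (g := τ g⁻¹) fun x => ?_
  rw [← Module.End.mul_apply, ← map_mul]; simp

lemma inducedVec_ne_zero {w : W} (hw : w ≠ 0) (i : Fin 6) : inducedVec ρ w i ≠ 0 := by
  rw [inducedVec, Ne, map_eq_zero_iff _ (act_injective _ _),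
    map_eq_zero_iff _ (indOne_injective _ _)]
  exact hw

/-- Write `g = t c` with `t` the coset representative for `g ▷ 0`; the factor `c` centralizes `genB
0` and acts by the character. -/
lemma act_indOne_eq {χ : Subgroup.centralizer {genB 0} → k} (hχ : ∀ c w, ρ c w = χ c • w)
    (g : GroupB) (w : W) : (induced (genB 0) ρ).act g (indOne (genB 0) ρ w) =
      χ ⟨_, inv_transversal_mul_mem g⟩ • inducedVec ρ w (rackAction g 0) := by
  have h1 := act_coe_indOne (genB 0) ρ ⟨_, inv_transversal_mul_mem g⟩ w
  rw [hχ, map_smul] at h1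
  rw [inducedVec, ← map_smul, ← h1, ← Module.End.mul_apply, ← map_mul]
  simp

lemma span_inducedVec {χ : Subgroup.centralizer {genB 0} → k} (hχ : ∀ c w, ρ c w = χ c • w)
    {w : W} (hw : Submodule.span k {w} = ⊤) :
    ⊤ ≤ Submodule.span k (Set.range (inducedVec ρ w)) := by
  set S := Submodule.span k (Set.range (inducedVec ρ w)) with hS
  have h : S.mkQ = 0 := by
    refine Representation.IndV.hom_ext _ _ fun h => LinearMap.ext fun x => ?_
    have hx : x ∈ Submodule.span k {w} := by rw [hw]; trivial
    obtain ⟨r, rfl⟩ := Submodule.mem_span_singleton.1 hx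
    have h2 := act_indOne (genB 0) ρ h⁻¹ w
    rw [inv_inv, act_indOne_eq ρ hχ] at h2
    rw [map_smul, map_smul]
    change r • S.mkQ (Representation.IndV.mk _ ρ h w) = r • 0
    rw [← h2]
    congr 1
    rw [Submodule.mkQ_apply, Submodule.Quotient.mk_eq_zero]
    exact Submodule.smul_mem _ _ (Submodule.subset_span ⟨_, rfl⟩)
  intro x _
  rw [← S.ker_mkQ, h]
  trivial

/-- The basis of the induced Yetter-Drinfeld module. -/
def inducedBasis {χ : Subgroup.centralizer {genB 0} → k} (hχ : ∀ c w, ρ c w = χ c • w)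
    {w : W} (hw0 : w ≠ 0) (hw : Submodule.span k {w} = ⊤) :
    Module.Basis (Fin 6) k (Representation.IndV (Subgroup.centralizer {genB 0}).subtype ρ) :=
  Module.Basis.mk (linearIndependent_of_component _ genB_injective fun i =>
    ⟨inducedVec_ne_zero ρ hw0 i, inducedVec_mem ρ w i⟩) (span_inducedVec ρ hχ hw)

lemma act_mul_apply (g h : GroupB)
    (x : Representation.IndV (Subgroup.centralizer {genB 0}).subtype ρ) :
    (induced (genB 0) ρ).act g ((induced (genB 0) ρ).act h x) =
      (induced (genB 0) ρ).act (g * h) x := by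
  rw [map_mul, Module.End.mul_apply]

/-- The structure constants of the action on `inducedVec`. -/
def structureConst (χ : Subgroup.centralizer {genB 0} → k) (i j : Fin 6) : k :=
  χ ⟨_, inv_transversal_mul_mem (genB i * transversal j)⟩

lemma act_inducedVec {χ : Subgroup.centralizer {genB 0} → k} (hχ : ∀ c w, ρ c w = χ c • w)
    (w : W) (i j : Fin 6) : (induced (genB 0) ρ).act (genB i) (inducedVec ρ w j) =
      structureConst χ i j • inducedVec ρ w (phiB i j) := by
  rw [inducedVec, act_mul_apply, act_indOne_eq ρ hχ, structureConst]
  congr 2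
  rw [map_mul, Equiv.Perm.mul_apply, (rackAction_transversal j).1, rackAction_genB]

lemma act_self_inducedVec {χ : Subgroup.centralizer {genB 0} → k} (hχ : ∀ c w, ρ c w = χ c • w)
    (w : W) (i : Fin 6) : (induced (genB 0) ρ).act (genB i) (inducedVec ρ w i) =
      χ cent1 • inducedVec ρ w i := by
  have h := act_coe_indOne (genB 0) ρ cent1 w
  rw [hχ, map_smul] at h
  rw [inducedVec, act_mul_apply, transversal_mul_genB_zero, ← act_mul_apply, ← map_smul, ← h]
  rfl

lemma act_opposite_inducedVec {χ : Subgroup.centralizer {genB 0} → k}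
    (hχ : ∀ c w, ρ c w = χ c • w) (w : W) (i : Fin 6) :
    (induced (genB 0) ρ).act (genB (opposite i)) (inducedVec ρ w i) =
      χ cent6 • inducedVec ρ w i := by
  have h := act_coe_indOne (genB 0) ρ cent6 w
  rw [hχ, map_smul] at h
  rw [inducedVec, act_mul_apply, transversal_mul_genB_five, ← act_mul_apply, ← map_smul, ← h]
  rfl

section Constants

variable {χ : Subgroup.centralizer {genB 0} → k} (hχ : ∀ c w, ρ c w = χ c • w) {w : W}
  (hw : w ≠ 0)
include hχ hw

lemma structureConst_self (i : Fin 6) : structureConst χ i i = χ cent1 := by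
  have h := act_inducedVec ρ hχ w i i
  have h2 : phiB i i = i := (by decide : ∀ i, phiB i i = i) i
  rw [act_self_inducedVec ρ hχ, h2] at h
  exact (smul_left_injective k (inducedVec_ne_zero ρ hw i) h).symm

lemma structureConst_opposite (i j : Fin 6) (hij : i ≠ j) (h : phiB i j = j) :
    structureConst χ i j = χ cent6 := by
  have h1 := act_inducedVec ρ hχ w i j
  have h2 : i = opposite j := by clear h1; revert i j; decide
  rw [h] at h1
  have h3 := act_opposite_inducedVec ρ hχ w j
  rw [← h2, h1] at h3
  exact smul_left_injective k (inducedVec_ne_zero ρ hw j) h3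

/-- With `c = i▷j`, the product is the eigenvalue of `x_c x_j x_i` on the basis vector of index `j`.
As `x_j x_i = x_{opposite c} x_j`, the central product `x_c x_{opposite c}` may be replaced by `x_j
x_{opposite j}`, whose factors act by known scalars. -/
lemma structureConst_triangle (i j : Fin 6) (hij : phiB i j ≠ j) :
    structureConst χ i j * structureConst χ (phiB i j) i * structureConst χ j (phiB i j) =
      χ cent1 * χ cent6 * χ cent1 := by
  obtain ⟨c, hc⟩ : ∃ c, phiB i j = c := ⟨_, rfl⟩
  have e : phiB c i = j ∧ phiB j c = i ∧ phiB j i = opposite c := by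
    revert i j c; decide +kernel
  have h1 := act_inducedVec ρ hχ w i j
  have h2 := act_inducedVec ρ hχ w j c
  have h3 := act_inducedVec ρ hχ w c i
  have h4 : genB c * (genB j * genB i) = genB j * genB (opposite j) * genB j := by
    rw [genB_mul j i, e.2.2, ← mul_assoc, genB_mul_opposite, genB_mul_opposite]
  have h5 : (induced (genB 0) ρ).act (genB c * (genB j * genB i)) (inducedVec ρ w j) =
      (structureConst χ i j * structureConst χ c i * structureConst χ j c) •
        inducedVec ρ w j := by
    rw [← act_mul_apply, ← act_mul_apply, h1, map_smul, map_smul, hc, h2, map_smul, e.2.1, h3,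
      e.1, smul_smul, smul_smul,
      mul_right_comm]
  rw [h4, ← act_mul_apply, ← act_mul_apply, act_self_inducedVec ρ hχ, map_smul, map_smul,
    act_opposite_inducedVec ρ hχ, map_smul, act_self_inducedVec ρ hχ, smul_smul, smul_smul] at h5
  have h6 := smul_left_injective k (inducedVec_ne_zero ρ hw j) h5
  rw [hc, ← h6]

end Constants

end YetterDrinfeld

/-! ### A basis on which all structure constants are -1 -/

section Signs

variable {k V : Type*} [Field k] [AddCommGroup V] [Module k V]

/-- The relations `hA` and `hO` are homogeneous quadratic, hence also hold for the operators `-A i`,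
which fix `e` for `i = 0, 5`. The claim says that the `-A i` permute the vectors `u j` as the rack
does. The equal squares `s2`, `s3`, `s4` identify the last vector with its other descriptions. -/
theorem act_eq_neg_of_rack {A : Fin 6 → Module.End k V}
    (hA : ∀ i j x, A i (A j x) = A (phiB i j) (A i x))
    (hO : ∀ i x, A i (A (opposite i) x) = A 0 (A 5 x)) {e : V} (h0 : A 0 e = -e) (h5 : A 5 e = -e)
    {u : Fin 6 → V} (hu : u = ![e, -A 2 e, -A 3 e, -A 4 e, -A 1 e, A 1 (A 1 e)]) (i j : Fin 6) :
    A i (u j) = -u (phiB i j) := by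
  have hA' {i j l : Fin 6} (h : phiB i j = l) (x : V) : A i (A j x) = A l (A i x) := by
    rw [hA, h]
  have hO' {i j : Fin 6} (h : opposite i = j) (x : V) : A i (A j x) = A 0 (A 5 x) := by
    rw [← h, hO]
  have z1 : A 0 (A 1 e) = -A 2 e := by rw [hA' (l := 2) (by decide), h0, map_neg]
  have z2 : A 0 (A 2 e) = -A 3 e := by rw [hA' (l := 3) (by decide), h0, map_neg]
  have z3 : A 0 (A 3 e) = -A 4 e := by rw [hA' (l := 4) (by decide), h0, map_neg]
  have z4 : A 0 (A 4 e) = -A 1 e := by rw [hA' (l := 1) (by decide), h0, map_neg]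
  have y1 : A 5 (A 1 e) = -A 4 e := by rw [hA' (l := 4) (by decide), h5, map_neg]
  have y2 : A 5 (A 2 e) = -A 1 e := by rw [hA' (l := 1) (by decide), h5, map_neg]
  have y3 : A 5 (A 3 e) = -A 2 e := by rw [hA' (l := 2) (by decide), h5, map_neg]
  have y4 : A 5 (A 4 e) = -A 3 e := by rw [hA' (l := 3) (by decide), h5, map_neg]
  have o13 : A 1 (A 3 e) = e := by rw [hO' (by decide), h5, map_neg, h0, neg_neg]
  have o31 : A 3 (A 1 e) = e := by rw [hO' (by decide), h5, map_neg, h0, neg_neg]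
  have o24 : A 2 (A 4 e) = e := by rw [hO' (by decide), h5, map_neg, h0, neg_neg]
  have o42 : A 4 (A 2 e) = e := by rw [hO' (by decide), h5, map_neg, h0, neg_neg]
  have a12 : A 1 (A 2 e) = -A 2 e := by rw [hA' (l := 0) (by decide), z1]
  have a14 : A 1 (A 4 e) = -A 4 e := by rw [hA' (l := 5) (by decide), y1]
  have a21 : A 2 (A 1 e) = -A 1 e := by rw [hA' (l := 5) (by decide), y2]
  have a23 : A 2 (A 3 e) = -A 3 e := by rw [hA' (l := 0) (by decide), z2]
  have a32 : A 3 (A 2 e) = -A 2 e := by rw [hA' (l := 5) (by decide), y3]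
  have a34 : A 3 (A 4 e) = -A 4 e := by rw [hA' (l := 0) (by decide), z3]
  have a41 : A 4 (A 1 e) = -A 1 e := by rw [hA' (l := 0) (by decide), z4]
  have a43 : A 4 (A 3 e) = -A 3 e := by rw [hA' (l := 5) (by decide), y4]
  have f0 : A 0 (A 1 (A 1 e)) = -A 1 (A 1 e) := by
    rw [← hA' (i := 1) (j := 2) (by decide), ← hA' (i := 1) (j := 5) (l := 2) (by decide), h5,
      map_neg, map_neg]
  have f5 : A 5 (A 1 (A 1 e)) = -A 1 (A 1 e) := by
    rw [← hA' (i := 1) (j := 4) (by decide), ← hA' (i := 1) (j := 0) (l := 4) (by decide), h0,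
      map_neg, map_neg]
  have s2 : A 2 (A 2 e) = A 1 (A 1 e) := by
    have := f0
    rwa [hA' (l := 2) (by decide), z1, map_neg, neg_inj] at this
  have s3 : A 3 (A 3 e) = A 1 (A 1 e) := by
    have := f0
    rwa [← s2, hA' (l := 3) (by decide), z2, map_neg, neg_inj, s2] at this
  have s4 : A 4 (A 4 e) = A 1 (A 1 e) := by
    have := f0
    rwa [← s3, hA' (l := 4) (by decide), z3, map_neg, neg_inj, s3] at this
  have f3 : A 3 (A 1 (A 1 e)) = A 1 e := by
    rw [hO' (by decide), y1, map_neg, z4, neg_neg]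
  have f4 : A 4 (A 1 (A 1 e)) = A 2 e := by
    rw [← s2, hO' (by decide), y2, map_neg, z1, neg_neg]
  have f1 : A 1 (A 1 (A 1 e)) = A 3 e := by
    nth_rw 1 [← s3]
    rw [hO' (by decide), y3, map_neg, z2, neg_neg]
  have f2 : A 2 (A 1 (A 1 e)) = A 4 e := by
    rw [← s4, hO' (by decide), y4, map_neg, z3, neg_neg]
  subst hu
  fin_cases i <;> fin_cases j <;>
    simp [Nichols.phiB_values, h0, h5, z1, z2, z3, z4, y1, y2, y3, y4, o13, o31, o24, o42, a12, a14, a21,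
      a23, a32, a34, a41, a43, f0, f1, f2, f3, f4, f5, s2, s3, s4]

end Signs

theorem prod_map_smul {R A I : Type*} [CommSemiring R] [Semiring A] [Algebra R A] (l : List I)
    (r : I → R) (f : I → A) :
    (l.map fun i => r i • f i).prod = (l.map r).prod • (l.map f).prod := by
  induction l with
  | nil => simp
  | cons i l ih => simp only [List.map_cons, List.prod_cons, ih, smul_mul_smul_comm]

namespace YetterDrinfeld

theorem exists_basis_braiding_eq_neg {k W : Type*} [Field k] [AddCommGroup W] [Module k W]
    (ρ : Representation k (Subgroup.centralizer {genB 0}) W) (hW : Module.finrank k W = 1)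
    (hV : Module.finrank k (Representation.IndV (Subgroup.centralizer {genB 0}).subtype ρ) = 6)
    (h1 : ρ cent1 = -1) (h6 : ρ cent6 = -1) :
    ∃ b : Module.Basis (Fin 6) k (Representation.IndV (Subgroup.centralizer {genB 0}).subtype ρ),
      (∀ i, b i ∈ (induced (genB 0) ρ).component (genB i)) ∧
      ∀ i j, (induced (genB 0) ρ).braiding (b i ⊗ₜ b j) = -(b (phiB i j) ⊗ₜ b i) := by
  obtain ⟨w, hw, -⟩ := finrank_eq_one_iff'.1 hW
  set M := induced (genB 0) ρ with hM
  set e := indOne (genB 0) ρ w with he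
  -- The sign is the parity of the number of generators in the corresponding element of
  -- `transversal`.
  let s : Fin 6 → k := ![1, -1, -1, -1, -1, 1]
  let u : Fin 6 → Representation.IndV (Subgroup.centralizer {genB 0}).subtype ρ :=
    fun i => s i • inducedVec ρ w i
  have hs : ∀ i, s i ≠ 0 := by intro i; fin_cases i <;> simp [s]
  have hu : ∀ i, u i ∈ M.component (genB i) := fun i =>
    M.smul_mem_component (inducedVec_mem ρ w i) _
  have hlin : LinearIndependent k u := linearIndependent_of_component M genB_injective fun i =>
    ⟨smul_ne_zero (hs i) (inducedVec_ne_zero ρ hw i), hu i⟩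
  have hcomm : ∀ i j x, M.act (genB i) (M.act (genB j) x) =
      M.act (genB (phiB i j)) (M.act (genB i) x) := fun i j x => by
    rw [act_mul_apply, act_mul_apply, genB_mul]
  have hopp : ∀ i x, M.act (genB i) (M.act (genB (opposite i)) x) =
      M.act (genB 0) (M.act (genB 5) x) := fun i x => by
    rw [act_mul_apply, act_mul_apply, genB_mul_opposite]
  have e0 : M.act (genB 0) e = -e := by
    have := act_coe_indOne (genB 0) ρ cent1 w
    rw [h1, LinearMap.neg_apply, map_neg] at this
    exact this
  have e5 : M.act (genB 5) e = -e := by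
    have := act_coe_indOne (genB 0) ρ cent6 w
    rw [h6, LinearMap.neg_apply, map_neg] at this
    exact this
  have hu' : u = ![e, -M.act (genB 2) e, -M.act (genB 3) e, -M.act (genB 4) e,
      -M.act (genB 1) e, M.act (genB 1) (M.act (genB 1) e)] := by
    funext i
    fin_cases i <;> simp [u, s, inducedVec, transversal, e, M]
  let b := basisOfLinearIndependentOfCardEqFinrank hlin (by rw [hV]; rfl)
  have hb : ⇑b = u := coe_basisOfLinearIndependentOfCardEqFinrank hlin _
  refine ⟨b, fun i => by rw [hb]; exact hu i, fun i j => ?_⟩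
  rw [hb, braiding_tmul _ (hu i),
    act_eq_neg_of_rack (A := fun i => M.act (genB i)) hcomm hopp e0 e5 hu', TensorProduct.neg_tmul]

end YetterDrinfeld

/-! ### The theorem -/

open YetterDrinfeld in
theorem proposition5 {k : Type u} [Field k] {W : Type v} [AddCommGroup W] [Module k W]
    (ρ : Representation k (Subgroup.centralizer {genB 0}) W) (hρ : ρ.IsAbsolutelySimple) :
    -- `ρ` is a linear character
    Module.finrank k W = 1 ∧
    -- `d_V = 6`
    Module.finrank k (Representation.IndV (Subgroup.centralizer {genB 0}).subtype ρ) = 6 ∧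
    -- the condition on the degree two part
    (Module.rank k (Nichols.homogeneous (YetterDrinfeld.induced (genB 0) ρ).braiding 2) ≤
        ((Module.finrank k (Representation.IndV (Subgroup.centralizer {genB 0}).subtype ρ) *
          (Module.finrank k (Representation.IndV (Subgroup.centralizer {genB 0}).subtype ρ) + 1) / 2
            : ℕ) : Cardinal) ↔
      ρ cent1 = -1 ∧ ρ cent6 = -1) ∧
    (ρ cent1 = -1 → ρ cent6 = -1 →
      -- the Hilbert series and the dimension
      Nichols.hilbertSeries (YetterDrinfeld.induced (genB 0) ρ).braiding =
        Nichols.qNumber 2 ^ 2 * Nichols.qNumber 3 ^ 2 * Nichols.qNumber 4 ^ 2 ∧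
      Module.rank k (Nichols.NicholsAlgebra (YetterDrinfeld.induced (genB 0) ρ).braiding) = 576 ∧
      -- the integral `v₁v₂v₁v₃v₂v₁v₄v₃v₂v₅v₄v₆`
      ∀ w : Fin 6 → Representation.IndV (Subgroup.centralizer {genB 0}).subtype ρ,
        (∀ i, w i ≠ 0 ∧ w i ∈ (YetterDrinfeld.induced (genB 0) ρ).component (genB i)) →
        Nichols.IsIntegral (YetterDrinfeld.induced (genB 0) ρ).braiding
          (([0, 1, 0, 2, 1, 0, 3, 2, 1, 4, 3, 5] : List (Fin 6)).map
            fun i => Nichols.ι (YetterDrinfeld.induced (genB 0) ρ).braiding (w i)).prod) := by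
  have hW : Module.finrank k W = 1 := by
    let _ : CommGroup (Subgroup.centralizer {genB 0}) :=
      { (inferInstance : Group (Subgroup.centralizer {genB 0})) with
        mul_comm := centralizer_mul_comm }
    exact Representation.IsAbsolutelySimple.finrank_eq_one (G := Subgroup.centralizer {genB 0})
      (ρ := ρ) hρ
  obtain ⟨w, hw, hspan⟩ := finrank_eq_one_iff'.1 hW
  have hχ : ∀ c, ∃ r : k, ∀ x, ρ c x = r • x := fun c => by
    obtain ⟨r, hr⟩ := hspan (ρ c w)
    refine ⟨r, fun x => ?_⟩
    obtain ⟨t, rfl⟩ := hspan x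
    rw [map_smul, ← hr, smul_comm]
  choose χ hχ using hχ
  have hw' : Submodule.span k {w} = ⊤ :=
    eq_top_iff.2 fun x _ => Submodule.mem_span_singleton.2 (hspan x)
  let b := inducedBasis ρ hχ hw hw'
  have hV : Module.finrank k (Representation.IndV (Subgroup.centralizer {genB 0}).subtype ρ) = 6 :=
    by rw [Module.finrank_eq_card_basis b]; rfl
  have hneg : ∀ c, χ c = -1 → ρ c = -1 := fun c hc => LinearMap.ext fun x => by
    rw [hχ, hc, neg_one_smul]; rfl
  rw [hV]
  refine ⟨hW, rfl, ⟨fun h => ?_, fun h => ?_⟩, fun h1 h6 => ?_⟩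
  · have hb : ∀ i, b i = inducedVec ρ w i := fun i => Module.Basis.mk_apply _ _ i
    have hc : ∀ i j, (induced (genB 0) ρ).braiding (b i ⊗ₜ b j) =
        structureConst χ i j • (b (phiB i j) ⊗ₜ b i) := fun i j => by
      rw [hb, hb, hb, braiding_tmul _ (inducedVec_mem ρ w i), act_inducedVec ρ hχ,
        TensorProduct.smul_tmul']
    obtain ⟨q1, -, q2⟩ := Nichols.scalars_of_rank_homogeneous_two_le b hc
      (structureConst_self ρ hχ hw) (structureConst_opposite ρ hχ hw)
      (structureConst_triangle ρ hχ hw) h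
    refine ⟨hneg _ q1, hneg _ ?_⟩
    -- The orbits of length three give `ρ(x_1)² ρ(x_6) = -1`, which determines `ρ(x_6)` once `ρ(x_1)
    -- = -1`.
    rw [q1] at q2
    linear_combination q2
  · obtain ⟨b, -, hc⟩ := exists_basis_braiding_eq_neg ρ hW hV h.1 h.2
    rw [Nichols.rank_homogeneous_two b hc]
    norm_num
  · obtain ⟨b, hb, hc⟩ := exists_basis_braiding_eq_neg ρ hW hV h1 h6
    refine ⟨Nichols.hilbertSeries_eq b hc, Nichols.rank_nicholsAlgebra b hc, fun w hw => ?_⟩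
    -- Each component of degree `genB i` is a line, so the given monomial is a non-zero multiple of
    -- the one in the rescaled basis.
    have e : ∀ i, w i = b.repr (w i) i • b i := fun i =>
      eq_smul_of_mem_component _ genB_injective b hb (hw i).2
    have hr : ∀ i, b.repr (w i) i ≠ 0 := fun i hi => (hw i).1 (by rw [e i, hi, zero_smul])
    have e' : (fun i => Nichols.ι (induced (genB 0) ρ).braiding (w i)) =
        fun i => b.repr (w i) i • Nichols.ι (induced (genB 0) ρ).braiding (b i) := by
      funext i
      rw [← map_smul, ← e]
    rw [e', prod_map_smul]
    refine Nichols.isIntegral_smul (List.prod_ne_zero fun h0 => ?_) (Nichols.isIntegral_topWord b hc)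
    obtain ⟨i, -, hi⟩ := List.mem_map.1 h0
    exact hr i hi

end
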